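/- Let $n\ge 1$, $\Gamma_1=\{y\in\mathbb R^n: y_1>0,\dots,y_n>0\}$ and $T_{\Gamma_1}=\mathbb R^n+i\Gamma_1\subset\mathbb C^n$. Let $H^2(T_{\Gamma_1})$ be the space of holomorphic functions $F$ on $T_{\Gamma_1}$ with $\|F\|^2=\sup_{y\in\Gamma_1}\int_{\mathbb R^n}|F(x+iy)|^2\,dx<\infty$, with inner product $\langle F,G\rangle=\int_{\mathbb R^n}F(\xi)\overline{G(\xi)}\,d\xi$, where $F(\xi)$ denotes the limit of $F(\xi+i\eta)$ in $L^2(\mathbb R^n)$ as $\eta\to0$, $\eta\in\Gamma_1$, and likewise for $G(\xi)$. Let $K(w,\overline z)=\prod_{k=1}^n\frac{-1}{2\pi i\,(w_k-\overline{z_k})}$ be the Cauchy--Szegő kernel. For $z\in T_{\Gamma_1}$ and $h\ge 0$ let $\mathcal A_h(z)$ be the set of all functions $\nabla_{l_1}\cdots\nabla_{l_h}K(\cdot,\overline z)$, where $l_1,\dots,l_h$ are unit vectors of $\mathbb C^n=\mathbb R^{2n}$ and $\nabla_l$ is the real directional derivative with respect to the parameter $z$. Fix a rule that attaches to every finite tuple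 $(z^{(1)},\dots,z^{(m)})$ of (not necessarily distinct) points of $T_{\Gamma_1}$ functions $\Phi_{z^{(1)}},\dots,\Phi_{z^{(m)}}$, where $\Phi_{z^{(k)}}$ depends only on $z^{(1)},\dots,z^{(k)}$, such that these functions are linearly independent and $\Phi_{z^{(k)}}$ is a finite complex linear combination of elements of $\mathcal A_{h_k}(z^{(k)})$; here $h_k\geq 0$ is determined by $\binom{h_k-1+n}{n}<l_k\le\binom{h_k+n}{n}$ with $l_k=\#\{j\le k: z^{(j)}=z^{(k)}\}$. (So $\Phi_{z^{(k)}}$ is a nonzero multiple of $K(\cdot,\overline{z^{(k)}})$ when $z^{(k)}$ occurs for the first time.) For $F\in H^2(T_{\Gamma_1})$ and points $z^{(1)},\dots,z^{(m)}\in T_{\Gamma_1}$ put $$F^*_{A_m}(z)=\sum_{j=1}^m\sum_{k=1}^m\langle F,\Phi_{z^{(j)}}\rangle\,\overline{(A_m^{-1})_{j,k}}\;\Phi_{z^{(k)}}(z),\qquad A_m=\big(\langle\Phi_{z^{(k)}},\Phi_{z^{(j)}}\rangle\big)_{j,k=1}^m .$$ Let $F\in H^2(T_{\Gamma_1})$ and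 let $(z^{(k)})_{k\ge1}$ be a sequence in $T_{\Gamma_1}$ such that, for every $m\ge0$, the point $z^{(m+1)}$ minimizes over all points of $T_{\Gamma_1}$ the quantity $\|F-F^*_{A_{m+1}}\|^2$, the points $z^{(1)},\dots,z^{(m)}$ being kept fixed. Then $F^*_{A_m}\to F$ as $m\to\infty$, uniformly on every compact subset of $T_{\Gamma_1}$. -/

import Mathlib

open MeasureTheory Filter Topology

noncomputable section

namespace HardyTube

/-- The first octant `Γ₁` of `ℝⁿ`. -/
def octant (n : ℕ) : Set (Fin n → ℝ) := {y | ∀ j, 0 < y j}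

/-- The tube `ℝⁿ + iΓ₁` over the first octant. -/
def tube (n : ℕ) : Set (Fin n → ℂ) := {z | (fun j => (z j).im) ∈ octant n}

/-- The point `x + iy` of `ℂⁿ`. -/
def pt {n : ℕ} (x y : Fin n → ℝ) : Fin n → ℂ := fun j => (x j : ℂ) + (y j : ℂ) * Complex.I

/-- The squared Hardy norm `sup_{y ∈ Γ₁} ∫ |F(x+iy)|² dx`, with values in `[0, ∞]`. -/
def normSq {n : ℕ} (F : (Fin n → ℂ) → ℂ) : ENNReal :=
  ⨆ y ∈ octant n, ∫⁻ x : Fin n → ℝ, ‖F (pt x y)‖ₑ ^ 2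

/-- Membership in the Hardy space `H²` of the tube. Functions are total functions on `ℂⁿ`, of which
only the values on the tube matter. -/
def MemHardy {n : ℕ} (F : (Fin n → ℂ) → ℂ) : Prop :=
  DifferentiableOn ℂ F (tube n) ∧ normSq F < ⊤

/-- `f` is the limit of `F(· + iη)` in `L²(ℝⁿ)` as `η → 0`, `η ∈ Γ₁`. -/
def IsBoundaryValue {n : ℕ} (F : (Fin n → ℂ) → ℂ) (f : (Fin n → ℝ) → ℂ) : Prop :=
  MemLp f 2 volume ∧
    Tendsto (fun η : Fin n → ℝ => eLpNorm (fun ξ : Fin n → ℝ => F (pt ξ η) - f ξ) 2 volume)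
      (𝓝[octant n] 0) (𝓝 0)

open Classical in
/-- The `L²` boundary value of `F`; it is determined almost everywhere. -/
def boundaryValue {n : ℕ} (F : (Fin n → ℂ) → ℂ) : (Fin n → ℝ) → ℂ :=
  if h : ∃ f, IsBoundaryValue F f then h.choose else 0

/-- The inner product `⟨F, G⟩ = ∫ F(ξ) conj(G(ξ)) dξ` of the boundary values. -/
def hardyInner {n : ℕ} (F G : (Fin n → ℂ) → ℂ) : ℂ :=
  ∫ ξ : Fin n → ℝ, boundaryValue F ξ * (starRingEnd ℂ) (boundaryValue G ξ)

/-- The Cauchy-Szegő kernel `K(w, z̄)`, written as `szego z w`. -/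
def szego {n : ℕ} (z w : Fin n → ℂ) : ℂ :=
  ∏ k, (-1) / (2 * (Real.pi : ℂ) * Complex.I * (w k - (starRingEnd ℂ) (z k)))

/-- Iterated real directional derivatives of `z ↦ K(·, z̄)` in the parameter `z`,
along the directions in a list. -/
def iterDirDeriv {n : ℕ} : List (Fin n → ℂ) → (Fin n → ℂ) → (Fin n → ℂ) → ℂ
  | [], z, w => szego z w
  | l :: L, z, w => lineDeriv ℝ (fun ζ => iterDirDeriv L ζ w) z l

/-- The functions `∇_{l₁} ⋯ ∇_{l_h} K(·, z̄)` at the point `z`, for unit vectors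
`l₁, …, l_h` of `ℂⁿ = ℝ²ⁿ`. -/
def dictionary {n : ℕ} (h : ℕ) (z : Fin n → ℂ) : Set ((Fin n → ℂ) → ℂ) :=
  {g | ∃ L : List (Fin n → ℂ),
    L.length = h ∧ (∀ l ∈ L, ∑ j, ‖l j‖ ^ 2 = 1) ∧ g = iterDirDeriv L z}

/-- A rule that attaches a function to a point `w`, given the points that precede `w`. -/
abbrev Rule (n : ℕ) : Type :=
  (m : ℕ) → (Fin m → (Fin n → ℂ)) → (Fin n → ℂ) → ((Fin n → ℂ) → ℂ)

/-- The functions `Φ_{p 0}, …, Φ_{p (m-1)}` which a rule attaches to the points of a tuple `p`. -/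
def Rule.system {n : ℕ} (Φ : Rule n) {m : ℕ} (p : Fin m → (Fin n → ℂ)) (k : Fin m) :
    (Fin n → ℂ) → ℂ :=
  Φ k (fun i : Fin (k : ℕ) => p (Fin.castLE k.isLt.le i)) (p k)

/-- The number of indices `j ≤ k` with `p j = p k`. -/
def mult {n m : ℕ} (p : Fin m → (Fin n → ℂ)) (k : Fin m) : ℕ :=
  Set.ncard {j : Fin m | j ≤ k ∧ p j = p k}

/-- A rule is admissible if, for all points `p 0, …, p (m-1)` of the tube, the attached functions
are linearly independent on the tube and the `k`-th one is a combination of derivatives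
of order `h` of the kernel at `p k`, where `binom(h-1+n, n) < mult p k ≤ binom(h+n, n)`. -/
def Rule.IsAdmissible {n : ℕ} (Φ : Rule n) : Prop :=
  ∀ (m : ℕ) (p : Fin m → (Fin n → ℂ)), (∀ i, p i ∈ tube n) →
    LinearIndependent ℂ (fun k : Fin m => (tube n).domRestrict (Φ.system p k)) ∧
    ∀ k : Fin m, ∃ h : ℕ,
      (h + n - 1).choose n < mult p k ∧ mult p k ≤ (h + n).choose n ∧
      Φ.system p k ∈ Submodule.span ℂ (dictionary h (p k))

/-- The matrix with entries `a_{j,k} = ⟨φ_k, φ_j⟩`. -/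
def gramMatrix {n m : ℕ} (φ : Fin m → ((Fin n → ℂ) → ℂ)) : Matrix (Fin m) (Fin m) ℂ :=
  Matrix.of fun j k => hardyInner (φ k) (φ j)

/-- The approximant `∑_j ∑_k ⟨F, Φ_j⟩ conj((A⁻¹)_{j,k}) Φ_k(w)` for the points of the tuple `p`. -/
def approximant {n : ℕ} (Φ : Rule n) (F : (Fin n → ℂ) → ℂ) {m : ℕ}
    (p : Fin m → (Fin n → ℂ)) (w : Fin n → ℂ) : ℂ :=
  ∑ j, ∑ k, hardyInner F (Φ.system p j) *
    (starRingEnd ℂ) ((gramMatrix (Φ.system p))⁻¹ j k) * Φ.system p k w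

/-- Each point `z m` of the sequence lies in the tube and minimizes, among all points `w` of the
tube, the squared norm of `F` minus its approximant for `z 0, …, z (m-1), w`. -/
def IsSelected {n : ℕ} (Φ : Rule n) (F : (Fin n → ℂ) → ℂ) (z : ℕ → (Fin n → ℂ)) : Prop :=
  ∀ m : ℕ, z m ∈ tube n ∧ ∀ w ∈ tube n,
    normSq (F - approximant Φ F (fun i : Fin (m + 1) => z i)) ≤
      normSq (F - approximant Φ F
        (Fin.snoc (α := fun _ => Fin n → ℂ) (fun i : Fin m => z i) w))

end HardyTube

end

/-! Let `R m` be the residual `F - F*_{A_m}`. The coefficients built from the inverse Gram matrix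
make the approximant the orthogonal projection of `F` onto the span `V m` of the attached functions,
so `‖R m - R l‖² = ‖R m‖² - ‖R l‖²` for `m ≤ l`, and the norms decrease.

Fix `w` in the tube, with kernel `K_w`. If `w` is already among the first `m` points, then `K_w`
lies in `V m` and `R m` vanishes at `w`. Otherwise appending `w` puts `K_w` into the span. The point
actually selected does at least as well as `w`, hence at least as well as subtracting the best
multiple of `K_w` from `R m`; therefore `|R m (w)|² ≤ ‖K_w‖² (‖R m‖² - ‖R (m+1)‖²)`. The right side
is the gap of a convergent sequence, so `R m → 0` pointwise on the tube.

Let `a = lim ‖R m‖²`. Fatou's lemma on each slice, applied to `R m - R l` as `l → ∞`, gives `‖R m‖²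
≤ ‖R m‖² - a`, so `a = 0`. Norm convergence implies uniform convergence on compact sets because
point evaluations are locally uniformly bounded (`exists_norm_sq_le_normSq`).

The rest is the theory of the Hardy space that this uses. A contour shift
(`integral_slice_mul_conj_shift`) yields `L²` boundary values and the identity of the Hardy norm
with their norm (`normSq_eq`). The reproducing property (`inner_bdry_szego`) comes from the
one-variable Poisson formula. Derivatives of the kernel belong to the space
(`memHardy_iterDirDeriv`). -/

namespace HardyTube

open scoped ENNReal

/-! ### Contour shift for correlations of slices. -/

/-- A continuous integrable function has integral zero if its integrals along long segments in a
fixed direction are controlled by the values of an integrable function at the end points. -/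
theorem integral_eq_zero_of_segment_bound {E : Type*} [NormedAddCommGroup E] [NormedSpace ℝ E]
    [SecondCountableTopology E] [MeasurableSpace E] [BorelSpace E] {μ : Measure E} [SFinite μ]
    [μ.IsAddHaarMeasure]
    {D : E → ℂ} (hD : Integrable D μ) (hDc : Continuous D) (u : E) {V : E → ℝ≥0∞}
    (hVm : AEMeasurable V μ) (hV : ∫⁻ x, V x ∂μ ≠ ⊤)
    (h : ∀ x, ∀ R : ℝ, 0 < R →
      ‖∫ τ in (-R)..R, D (x + τ • u)‖ₑ ≤ V (x + R • u) + V (x - R • u)) :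
    ∫ x, D x ∂μ = 0 := by
  -- Integrating the segment integral over all base points `x` gives `2R ∫ D` by translation
  -- invariance, while the bound at the two end points contributes only `2 ∫ V`, independently of
  -- `R`. Letting `R` grow forces `∫ D = 0`.
  have key : ∀ R : ℝ, 0 < R →
      ENNReal.ofReal (2 * R) * ‖∫ x, D x ∂μ‖ₑ ≤ 2 * ∫⁻ x, V x ∂μ := by
    intro R hR
    have hint : Integrable (Function.uncurry fun (τ : ℝ) (x : E) => D (x + τ • u))
        ((volume.restrict (Set.uIoc (-R) R)).prod μ) := by
      have hc : Continuous (Function.uncurry fun (τ : ℝ) (x : E) => D (x + τ • u)) := by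
        unfold Function.uncurry; fun_prop
      rw [integrable_prod_iff hc.aestronglyMeasurable]
      refine ⟨Eventually.of_forall fun τ => hD.comp_add_right (τ • u), ?_⟩
      have : (fun τ : ℝ => ∫ x, ‖Function.uncurry (fun (τ : ℝ) (x : E) => D (x + τ • u)) (τ, x)‖ ∂μ)
          = fun _ => ∫ x, ‖D x‖ ∂μ := by
        ext τ
        exact integral_add_right_eq_self (fun x => ‖D x‖) (τ • u)
      rw [this]
      exact integrableOn_const (by simp [Set.uIoc])
    have hswap := intervalIntegral_integral_swap hint
    have hl : ∫ τ in (-R)..R, ∫ x, D (x + τ • u) ∂μ = (2 * R : ℝ) • ∫ x, D x ∂μ := by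
      simp_rw [integral_add_right_eq_self]
      rw [intervalIntegral.integral_const]
      congr 1; ring
    have hsm : ∀ v : E, AEMeasurable (fun x => V (x + v)) μ := fun v =>
      hVm.comp_quasiMeasurePreserving (measurePreserving_add_right μ v).quasiMeasurePreserving
    calc ENNReal.ofReal (2 * R) * ‖∫ x, D x ∂μ‖ₑ
        = ‖(2 * R : ℝ) • ∫ x, D x ∂μ‖ₑ := by
          rw [enorm_smul, Real.enorm_of_nonneg (by positivity)]
      _ = ‖∫ x, (∫ τ in (-R)..R, D (x + τ • u)) ∂μ‖ₑ := by rw [← hl, hswap]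
      _ ≤ ∫⁻ x, ‖∫ τ in (-R)..R, D (x + τ • u)‖ₑ ∂μ := enorm_integral_le_lintegral_enorm _
      _ ≤ ∫⁻ x, (V (x + R • u) + V (x - R • u)) ∂μ := lintegral_mono fun x => h x R hR
      _ = 2 * ∫⁻ x, V x ∂μ := by
          rw [lintegral_add_left' (hsm _)]
          simp_rw [sub_eq_add_neg]
          rw [lintegral_add_right_eq_self, lintegral_add_right_eq_self, two_mul]
  by_contra hne
  obtain ⟨W, hW⟩ : ∃ W : NNReal, ∫⁻ x, V x ∂μ = W := ⟨_, (ENNReal.coe_toNNReal hV).symm⟩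
  rw [hW] at key
  have hr : 0 < ‖∫ x, D x ∂μ‖ := by simpa using hne
  have := key ((W : ℝ) / ‖∫ x, D x ∂μ‖ + 1) (by positivity)
  rw [← ofReal_norm, ← ENNReal.ofReal_mul (by positivity),
    ← ENNReal.ofReal_coe_nnreal, show (2 : ℝ≥0∞) = ENNReal.ofReal 2 by simp,
    ← ENNReal.ofReal_mul (by positivity), ENNReal.ofReal_le_ofReal_iff (by positivity)] at this
  have h2 : (W : ℝ) / ‖∫ x, D x ∂μ‖ * ‖∫ x, D x ∂μ‖ = W := by field_simp
  nlinarith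

variable {n : ℕ}

theorem pt_mem_tube {x y : Fin n → ℝ} : pt x y ∈ tube n ↔ y ∈ octant n := by
  simp [tube, pt, octant]

theorem continuous_pt : Continuous fun p : (Fin n → ℝ) × (Fin n → ℝ) => pt p.1 p.2 := by
  unfold pt; fun_prop

theorem isOpen_octant : IsOpen (octant n) := by
  simp only [octant, Set.ofPred_forall]
  exact isOpen_iInter_of_finite fun j => isOpen_lt continuous_const (continuous_apply j)

theorem isOpen_tube : IsOpen (tube n) :=
  isOpen_octant.preimage (by fun_prop : Continuous fun z : Fin n → ℂ => fun j => (z j).im)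

theorem octant_segment {a b : Fin n → ℝ} (ha : a ∈ octant n) (hb : b ∈ octant n) {s : ℝ}
    (hs : s ∈ Set.Icc (0 : ℝ) 1) : a + s • (b - a) ∈ octant n := by
  intro j
  have h1 := ha j
  have h2 := hb j
  obtain ⟨h3, h4⟩ := hs
  simp only [Pi.add_apply, Pi.smul_apply, Pi.sub_apply, smul_eq_mul]
  rcases h4.eq_or_lt with rfl | h4
  · linarith
  · nlinarith [mul_nonneg h3 h2.le, mul_pos (sub_pos.2 h4) h1]

namespace MemHardy

variable {F G : (Fin n → ℂ) → ℂ}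

theorem continuous_slice (hF : MemHardy F) {y : Fin n → ℝ} (hy : y ∈ octant n) :
    Continuous fun x => F (pt x y) := by
  rw [continuous_iff_continuousAt]
  intro x
  have h1 : ContinuousAt F (pt x y) :=
    (hF.1.continuousOn).continuousAt (isOpen_tube.mem_nhds (pt_mem_tube.2 hy))
  exact ContinuousAt.comp (f := fun x => pt x y) h1
    (continuous_pt.comp (by fun_prop : Continuous fun x => (x, y))).continuousAt

theorem lintegral_slice_le {y : Fin n → ℝ} (hy : y ∈ octant n) :
    ∫⁻ x : Fin n → ℝ, ‖F (pt x y)‖ₑ ^ 2 ≤ normSq F :=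
  le_iSup₂_of_le (f := fun y (_ : y ∈ octant n) => ∫⁻ x : Fin n → ℝ, ‖F (pt x y)‖ₑ ^ 2) y hy le_rfl

theorem memLp_slice (hF : MemHardy F) {y : Fin n → ℝ} (hy : y ∈ octant n) :
    MemLp (fun x => F (pt x y)) 2 volume := by
  refine ⟨(hF.continuous_slice hy).aestronglyMeasurable, ?_⟩
  rw [eLpNorm_lt_top_iff_lintegral_rpow_enorm_lt_top (by simp) (by simp)]
  simpa using (lintegral_slice_le hy).trans_lt hF.2

/-- The contour shift: correlations of the slices of `F` depend only on the sum of the heights. -/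
theorem integral_slice_mul_conj_shift (hF : MemHardy F) {a b u : Fin n → ℝ}
    (ha : a ∈ octant n) (hb : b ∈ octant n) (hau : a + u ∈ octant n) (hbu : b - u ∈ octant n) :
    ∫ x, F (pt x (a + u)) * (starRingEnd ℂ) (F (pt x (b - u))) =
      ∫ x, F (pt x a) * (starRingEnd ℂ) (F (pt x b)) := by
  have ha' : ∀ {s : ℝ}, s ∈ Set.Icc (0 : ℝ) 1 → a + s • u ∈ octant n := fun hs => by
    simpa using octant_segment ha hau hs
  have hb' : ∀ {s : ℝ}, s ∈ Set.Icc (0 : ℝ) 1 → b - s • u ∈ octant n := fun hs => by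
    simpa [sub_eq_add_neg] using octant_segment hb hbu hs
  set S : (Fin n → ℝ) → ℝ → ℂ := fun x s =>
    F (pt x (a + s • u)) * (starRingEnd ℂ) (F (pt x (b - s • u))) with hS
  have hSint : ∀ s ∈ Set.Icc (0 : ℝ) 1, Integrable (fun x => S x s) := fun s hs =>
    (hF.memLp_slice (hb' hs)).star.integrable_mul (hF.memLp_slice (ha' hs)) |>.congr
      (Eventually.of_forall fun x => by simp [S, mul_comm])
  have hSc : ∀ s ∈ Set.Icc (0 : ℝ) 1, Continuous (fun x => S x s) := fun s hs =>
    (hF.continuous_slice (ha' hs)).mul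
      (Complex.continuous_conj.comp (hF.continuous_slice (hb' hs)))
  have hSjoint : ContinuousOn (Function.uncurry S) (Set.univ ×ˢ Set.Icc (0 : ℝ) 1) := by
    refine ContinuousOn.mul ?_ (Complex.continuous_conj.comp_continuousOn ?_)
    · refine hF.1.continuousOn.comp (f := fun p : (Fin n → ℝ) × ℝ => pt p.1 (a + p.2 • u))
        (continuous_pt.comp (by fun_prop :
          Continuous fun p : (Fin n → ℝ) × ℝ => (p.1, a + p.2 • u))).continuousOn ?_
      rintro ⟨x, s⟩ ⟨-, hs⟩
      exact pt_mem_tube.2 (ha' hs)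
    · refine hF.1.continuousOn.comp (f := fun p : (Fin n → ℝ) × ℝ => pt p.1 (b - p.2 • u))
        (continuous_pt.comp (by fun_prop :
          Continuous fun p : (Fin n → ℝ) × ℝ => (p.1, b - p.2 • u))).continuousOn ?_
      rintro ⟨x, s⟩ ⟨-, hs⟩
      exact pt_mem_tube.2 (hb' hs)
  have hSaem : AEMeasurable (fun p : (Fin n → ℝ) × ℝ => ‖S p.1 p.2‖ₑ)
      ((volume : Measure (Fin n → ℝ)).prod (volume.restrict (Set.Icc (0 : ℝ) 1))) := by
    have h1 := hSjoint.aemeasurable (μ := (volume : Measure (Fin n → ℝ)).prod volume)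
      (MeasurableSet.univ.prod measurableSet_Icc)
    rw [← Measure.prod_restrict, Measure.restrict_univ] at h1
    exact h1.enorm
  -- `V x` dominates the integral over a vertical side of the rectangle used below. It is integrable
  -- because `|pq| ≤ |p|² + |q|²` bounds each slice by twice the Hardy norm squared.
  set V : (Fin n → ℝ) → ℝ≥0∞ := fun x => ∫⁻ s in Set.Icc (0 : ℝ) 1, ‖S x s‖ₑ with hV
  have hVle : ∫⁻ x, V x ≠ ⊤ := by
    rw [lintegral_lintegral_swap (f := fun x s => ‖S x s‖ₑ) hSaem]
    have : ∀ s ∈ Set.Icc (0 : ℝ) 1, ∫⁻ x, ‖S x s‖ₑ ≤ normSq F + normSq F := by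
      intro s hs
      calc ∫⁻ x, ‖S x s‖ₑ
          ≤ ∫⁻ x, (‖F (pt x (a + s • u))‖ₑ ^ 2 + ‖F (pt x (b - s • u))‖ₑ ^ 2) := by
            refine lintegral_mono fun x => ?_
            simp only [S, enorm_mul, RCLike.enorm_conj]
            generalize ‖F (pt x (a + s • u))‖ₑ = p
            generalize ‖F (pt x (b - s • u))‖ₑ = q
            rcases le_total p q with h | h
            · calc p * q ≤ q * q := by gcongr
                _ ≤ p ^ 2 + q ^ 2 := by rw [← sq]; exact le_add_self
            · calc p * q ≤ p * p := by gcongr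
                _ ≤ p ^ 2 + q ^ 2 := by rw [← sq]; exact le_self_add
        _ ≤ _ := by
            rw [lintegral_add_left]
            · exact add_le_add (lintegral_slice_le (ha' hs)) (lintegral_slice_le (hb' hs))
            · exact (hF.continuous_slice (ha' hs)).enorm.measurable.pow_const 2
    refine ne_top_of_le_ne_top ?_ (setLIntegral_mono' measurableSet_Icc this)
    simp [hF.2.ne]
  have h01 : (0 : ℝ) ∈ Set.Icc (0 : ℝ) 1 := by simp
  have h11 : (1 : ℝ) ∈ Set.Icc (0 : ℝ) 1 := by simp
  have main : ∫ x, (S x 0 - S x 1) = 0 := by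
    refine integral_eq_zero_of_segment_bound ((hSint 0 h01).sub (hSint 1 h11))
      ((hSc 0 h01).sub (hSc 1 h11)) u (V := V) hSaem.lintegral_prod_right' hVle ?_
    intro x R hR
    -- Conjugating both the parameter and the value of the second factor makes the product
    -- holomorphic in `ζ`. At `ζ = τ + is` it equals `S (x + τ u) s`, so Cauchy's theorem on `[-R,
    -- R] × [0, 1]` compares heights `0` and `1`.
    have hdiff : DifferentiableOn ℂ (fun ζ : ℂ =>
        F (fun j => (pt x a j) + ζ * (u j : ℂ)) *
          (starRingEnd ℂ) (F (fun j => (pt x b j) + (starRingEnd ℂ) ζ * (u j : ℂ))))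
        {ζ : ℂ | ζ.im ∈ Set.Icc (0 : ℝ) 1} := by
      intro ζ hζ
      have h1 : (fun j => (pt x a j) + ζ * (u j : ℂ)) ∈ tube n := by
        intro j
        have := ha' hζ j
        simpa [pt, mul_comm] using this
      have h2 : (fun j => (pt x b j) + (starRingEnd ℂ) ζ * (u j : ℂ)) ∈ tube n := by
        intro j
        have := hb' hζ j
        simpa [pt, mul_comm, sub_eq_add_neg] using this
      have d1 : DifferentiableAt ℂ (fun ζ : ℂ => F (fun j => (pt x a j) + ζ * (u j : ℂ))) ζ :=
        DifferentiableAt.comp (g := F) (f := fun ζ : ℂ => fun j => (pt x a j) + ζ * (u j : ℂ)) ζ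
          ((hF.1 _ h1).differentiableAt (isOpen_tube.mem_nhds h1)) (by fun_prop)
      have d2 : DifferentiableAt ℂ (fun ζ : ℂ => F (fun j => (pt x b j) + ζ * (u j : ℂ)))
          ((starRingEnd ℂ) ζ) :=
        DifferentiableAt.comp (g := F) (f := fun ζ : ℂ => fun j => (pt x b j) + ζ * (u j : ℂ))
          ((starRingEnd ℂ) ζ)
          ((hF.1 _ h2).differentiableAt (isOpen_tube.mem_nhds h2)) (by fun_prop)
      have d3 := d2.conj_conj
      rw [Complex.conj_conj] at d3
      exact (d1.mul d3).differentiableWithinAt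
    have hval : ∀ τ s : ℝ, (fun ζ : ℂ =>
        F (fun j => (pt x a j) + ζ * (u j : ℂ)) *
          (starRingEnd ℂ) (F (fun j => (pt x b j) + (starRingEnd ℂ) ζ * (u j : ℂ))))
        ((τ : ℂ) + s * Complex.I) = S (x + τ • u) s := by
      intro τ s
      simp only [S]
      congr 2
      · ext j; simp [pt]; ring
      · congr 1; ext j; simp [pt]; ring
    have hrect := Complex.integral_boundary_rect_eq_zero_of_differentiableOn _
      ((-R : ℝ) : ℂ) ((R : ℂ) + (1 : ℝ) * Complex.I) (hdiff.mono (by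
        intro ζ hζ
        simpa [Complex.mem_reProdIm] using hζ.2))
    have e1 : ((-R : ℝ) : ℂ).im = 0 := by simp
    have e2 : ((R : ℂ) + (1 : ℝ) * Complex.I).im = 1 := by simp
    have e3 : ((-R : ℝ) : ℂ).re = -R := by simp
    have e4 : ((R : ℂ) + (1 : ℝ) * Complex.I).re = R := by simp
    rw [e1, e2, e3, e4] at hrect
    simp only [hval] at hrect
    have hcl : ∀ s ∈ Set.Icc (0 : ℝ) 1, IntervalIntegrable (fun τ : ℝ => S (x + τ • u) s)
        volume (-R) R := fun s hs =>
      ((hSc s hs).comp (by fun_prop : Continuous fun τ : ℝ => x + τ • u)).intervalIntegrable _ _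
    rw [intervalIntegral.integral_sub (hcl 0 h01) (hcl 1 h11)]
    have hside : ∀ v : Fin n → ℝ, ‖∫ s in (0 : ℝ)..1, S v s‖ₑ ≤ V v := by
      intro v
      rw [intervalIntegral.integral_of_le zero_le_one]
      exact (enorm_integral_le_lintegral_enorm _).trans (lintegral_mono_set Set.Ioc_subset_Icc_self)
    have heq : (∫ τ in (-R)..R, S (x + τ • u) 0) - (∫ τ in (-R)..R, S (x + τ • u) 1) =
        Complex.I • (∫ s in (0 : ℝ)..1, S (x + (-R) • u) s) -
          Complex.I • (∫ s in (0 : ℝ)..1, S (x + R • u) s) := by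
      linear_combination hrect
    rw [heq]
    refine (enorm_sub_le).trans ?_
    rw [enorm_smul, enorm_smul, add_comm]
    have : ‖Complex.I‖ₑ = 1 := by simp [← ofReal_norm]
    rw [this, one_mul, one_mul]
    refine add_le_add (hside _) ?_
    rw [show x - R • u = x + (-R) • u by module]
    exact hside _
  rw [integral_sub (hSint 0 h01) (hSint 1 h11), sub_eq_zero] at main
  simpa [S] using main.symm

end MemHardy
end HardyTube

/-! ### Boundary values in `L²` and the Hardy norm. -/

namespace HardyTube

open scoped ENNReal

variable {n : ℕ} {F G : (Fin n → ℂ) → ℂ}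

open Classical in
/-- The slice of `F` at height `y` as an element of `L²`. -/
noncomputable def sliceLp (F : (Fin n → ℂ) → ℂ) (y : Fin n → ℝ) :
    Lp ℂ 2 (volume : Measure (Fin n → ℝ)) :=
  if h : MemLp (fun x => F (pt x y)) 2 volume then h.toLp else 0

theorem tendsto_one_div_octant :
    Tendsto (fun (k : ℕ) (_ : Fin n) => 1 / ((k : ℝ) + 1)) atTop (𝓝[octant n] 0) :=
  tendsto_nhdsWithin_iff.2 ⟨tendsto_pi_nhds.2 fun _ => tendsto_one_div_add_atTop_nhds_zero_nat,
    Eventually.of_forall fun _ _ => by positivity⟩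

instance neBot_nhdsWithin_octant : (𝓝[octant n] (0 : Fin n → ℝ)).NeBot :=
  tendsto_one_div_octant.neBot

theorem eventually_le_octant {y : Fin n → ℝ} (hy : y ∈ octant n) :
    ∀ᶠ η in 𝓝[octant n] (0 : Fin n → ℝ), η ≤ y := by
  refine eventually_nhdsWithin_of_eventually_nhds ?_
  have : ∀ j, ∀ᶠ η : Fin n → ℝ in 𝓝 0, η j ≤ y j := fun j =>
    (((continuous_apply j).tendsto (0 : Fin n → ℝ)).eventually_lt_const (hy j)).mono
      fun _ h => h.le
  exact (eventually_all.2 this).mono fun η h j => h j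

theorem lintegral_enorm_sq_toLp {α : Type*} [MeasurableSpace α] {μ : Measure α} {f : α → ℂ}
    (hf : MemLp f 2 μ) : ∫⁻ x, ‖f x‖ₑ ^ 2 ∂μ = ENNReal.ofReal (‖hf.toLp‖ ^ 2) := by
  rw [Lp.norm_toLp, ← ENNReal.toReal_pow, ENNReal.ofReal_toReal (ENNReal.pow_ne_top hf.2.ne),
    eLpNorm_eq_lintegral_rpow_enorm_toReal (by simp) (by simp), ← ENNReal.rpow_natCast,
    ← ENNReal.rpow_mul]
  simp

theorem inner_toLp {α : Type*} [MeasurableSpace α] {μ : Measure α} {f g : α → ℂ}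
    (hf : MemLp f 2 μ) (hg : MemLp g 2 μ) :
    inner ℂ hg.toLp hf.toLp = ∫ x, f x * (starRingEnd ℂ) (g x) ∂μ := by
  rw [L2.inner_def]
  refine integral_congr_ae ?_
  filter_upwards [hf.coeFn_toLp, hg.coeFn_toLp] with x h1 h2
  rw [h1, h2, RCLike.inner_apply]

namespace MemHardy

theorem sliceLp_eq (hF : MemHardy F) {y : Fin n → ℝ} (hy : y ∈ octant n) :
    sliceLp F y = (hF.memLp_slice hy).toLp := dif_pos _

theorem norm_sliceLp_sq (hF : MemHardy F) {y : Fin n → ℝ} (hy : y ∈ octant n) :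
    ENNReal.ofReal (‖sliceLp F y‖ ^ 2) = ∫⁻ x : Fin n → ℝ, ‖F (pt x y)‖ₑ ^ 2 := by
  rw [hF.sliceLp_eq hy, lintegral_enorm_sq_toLp]

theorem norm_sliceLp_sq_le (hF : MemHardy F) {y : Fin n → ℝ} (hy : y ∈ octant n) :
    ‖sliceLp F y‖ ^ 2 ≤ (normSq F).toReal := by
  rw [← ENNReal.ofReal_le_iff_le_toReal hF.2.ne, hF.norm_sliceLp_sq hy]
  exact lintegral_slice_le hy

/-- Shifting the contour by half of `y' - y` moves both heights to their midpoint. -/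
theorem inner_sliceLp (hF : MemHardy F) {y y' : Fin n → ℝ} (hy : y ∈ octant n)
    (hy' : y' ∈ octant n) (hm : (2⁻¹ : ℝ) • (y + y') ∈ octant n) :
    inner ℂ (sliceLp F y') (sliceLp F y) = (‖sliceLp F ((2⁻¹ : ℝ) • (y + y'))‖ : ℂ) ^ 2 := by
  have hself : (‖sliceLp F ((2⁻¹ : ℝ) • (y + y'))‖ : ℂ) ^ 2 =
      inner ℂ (sliceLp F ((2⁻¹ : ℝ) • (y + y'))) (sliceLp F ((2⁻¹ : ℝ) • (y + y'))) := by
    rw [inner_self_eq_norm_sq_to_K (𝕜 := ℂ)]; simp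
  rw [hself]
  rw [hF.sliceLp_eq hy, hF.sliceLp_eq hy', hF.sliceLp_eq hm,
    inner_toLp, inner_toLp]
  have e1 : y + (2⁻¹ : ℝ) • (y' - y) = (2⁻¹ : ℝ) • (y + y') := by module
  have e2 : y' - (2⁻¹ : ℝ) • (y' - y) = (2⁻¹ : ℝ) • (y + y') := by module
  have := hF.integral_slice_mul_conj_shift (u := (2⁻¹ : ℝ) • (y' - y)) hy hy'
    (by rwa [e1]) (by rwa [e2])
  rw [e1, e2] at this
  exact this.symm

theorem midpoint_mem_octant {y y' : Fin n → ℝ} (hy : y ∈ octant n) (hy' : y' ∈ octant n) :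
    (2⁻¹ : ℝ) • (y + y') ∈ octant n := fun j => by
  have := hy j
  have := hy' j
  simp only [Pi.smul_apply, Pi.add_apply, smul_eq_mul]
  positivity

theorem norm_sliceLp_sub_sq (hF : MemHardy F) {y y' : Fin n → ℝ} (hy : y ∈ octant n)
    (hy' : y' ∈ octant n) :
    ‖sliceLp F y - sliceLp F y'‖ ^ 2 = ‖sliceLp F y‖ ^ 2 + ‖sliceLp F y'‖ ^ 2 -
      2 * ‖sliceLp F ((2⁻¹ : ℝ) • (y + y'))‖ ^ 2 := by
  rw [norm_sub_sq (𝕜 := ℂ), ← inner_conj_symm,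
    hF.inner_sliceLp hy hy' (midpoint_mem_octant hy hy')]
  have : RCLike.re ((starRingEnd ℂ) ((‖sliceLp F ((2⁻¹ : ℝ) • (y + y'))‖ : ℂ) ^ 2)) =
      ‖sliceLp F ((2⁻¹ : ℝ) • (y + y'))‖ ^ 2 := by
    rw [← Complex.ofReal_pow, Complex.conj_ofReal]; exact Complex.ofReal_re _
  rw [this]; ring

/-- By `norm_sliceLp_sub_sq` the squared slice norm is midpoint convex. Along the points `y + j (y'
- y)`, which stay in the octant, it is a convex bounded sequence, and such a sequence cannot have a
positive first increment. -/
theorem norm_sliceLp_antitone (hF : MemHardy F) {y y' : Fin n → ℝ} (hy : y ∈ octant n)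
    (hyy' : y ≤ y') : ‖sliceLp F y'‖ ≤ ‖sliceLp F y‖ := by
  set v := y' - y with hv
  have hmem : ∀ j : ℕ, y + (j : ℝ) • v ∈ octant n := fun j i => by
    have h1 := hy i
    have h2 := hyy' i
    simp only [Pi.add_apply, Pi.smul_apply, smul_eq_mul, hv, Pi.sub_apply]
    have : 0 ≤ (j : ℝ) * (y' i - y i) := mul_nonneg (by positivity) (by linarith)
    linarith
  set a : ℕ → ℝ := fun j => ‖sliceLp F (y + (j : ℝ) • v)‖ ^ 2 with ha
  have hconv : ∀ j, a (j + 1) - a j ≤ a (j + 2) - a (j + 1) := by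
    intro j
    have h := hF.norm_sliceLp_sub_sq (hmem j) (hmem (j + 2))
    have e : (2⁻¹ : ℝ) • (y + (j : ℝ) • v + (y + ((j + 2 : ℕ) : ℝ) • v)) =
        y + ((j + 1 : ℕ) : ℝ) • v := by
      push_cast; module
    rw [e] at h
    have h0 := sq_nonneg ‖sliceLp F (y + (j : ℝ) • v) - sliceLp F (y + ((j + 2 : ℕ) : ℝ) • v)‖
    simp only [ha]
    linarith
  have hstep : ∀ j, a 1 - a 0 ≤ a (j + 1) - a j := by
    intro j
    induction j with
    | zero => simp
    | succ j ih => exact ih.trans (hconv j)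
  have hgrow : ∀ j : ℕ, (j : ℝ) * (a 1 - a 0) ≤ a j - a 0 := by
    intro j
    induction j with
    | zero => simp
    | succ j ih => have := hstep j; push_cast; linarith
  have hle : a 1 ≤ a 0 := by
    by_contra hlt
    push Not at hlt
    obtain ⟨j, hj⟩ := exists_nat_gt ((normSq F).toReal / (a 1 - a 0))
    rw [div_lt_iff₀ (by linarith)] at hj
    have h1 := hgrow j
    have h2 : a j ≤ (normSq F).toReal := hF.norm_sliceLp_sq_le (hmem j)
    have h3 : 0 ≤ a 0 := sq_nonneg _
    linarith
  simp only [ha, Nat.cast_one, Nat.cast_zero, one_smul, zero_smul, add_zero, hv,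
    add_sub_cancel] at hle
  exact (sq_le_sq₀ (norm_nonneg _) (norm_nonneg _)).1 hle

/-- Choose `y₀` whose squared slice norm is within `ε² / 2` of the supremum. By monotonicity the
midpoint of two heights below `y₀` also has a squared norm that large, and `norm_sliceLp_sub_sq`
then makes the two slices `ε`-close. The Cauchy criterion in `L²` applies. -/
theorem exists_tendsto_sliceLp (hF : MemHardy F) :
    ∃ f, Tendsto (sliceLp F) (𝓝[octant n] 0) (𝓝 f) := by
  rw [← cauchy_map_iff_exists_tendsto, Metric.cauchy_iff]
  refine ⟨inferInstance, fun ε hε => ?_⟩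
  set T : Set ℝ := (fun y => ‖sliceLp F y‖ ^ 2) '' octant n with hT
  have hTne : T.Nonempty := ⟨_, (fun _ => 1), fun _ => one_pos, rfl⟩
  have hTb : BddAbove T := ⟨(normSq F).toReal, by
    rintro _ ⟨y, hy, rfl⟩; exact hF.norm_sliceLp_sq_le hy⟩
  obtain ⟨_, ⟨y₀, hy₀, rfl⟩, hlt⟩ := exists_lt_of_lt_csSup hTne
    (sub_lt_self (sSup T) (by positivity : 0 < ε ^ 2 / 2))
  refine ⟨sliceLp F '' (octant n ∩ Set.Iic y₀), image_mem_map ?_, ?_⟩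
  · exact inter_mem self_mem_nhdsWithin (eventually_le_octant hy₀)
  · rintro _ ⟨y, ⟨hy, hyl⟩, rfl⟩ _ ⟨y', ⟨hy', hyl'⟩, rfl⟩
    rw [dist_eq_norm]
    have hm := midpoint_mem_octant hy hy'
    have hml : (2⁻¹ : ℝ) • (y + y') ≤ y₀ := fun j => by
      have := hyl j
      have := hyl' j
      simp only [Pi.smul_apply, Pi.add_apply, smul_eq_mul]
      linarith
    have h1 := hF.norm_sliceLp_antitone hm hml
    have h2 : ‖sliceLp F y₀‖ ^ 2 ≤ ‖sliceLp F ((2⁻¹ : ℝ) • (y + y'))‖ ^ 2 := by gcongr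
    have h3 := le_csSup hTb ⟨y, hy, rfl⟩
    have h4 := le_csSup hTb ⟨y', hy', rfl⟩
    have h5 := hF.norm_sliceLp_sub_sq hy hy'
    have : ‖sliceLp F y - sliceLp F y'‖ ^ 2 < ε ^ 2 := by
      simp only at h3 h4 hlt
      linarith
    exact lt_of_pow_lt_pow_left₀ 2 hε.le this

theorem isBoundaryValue_iff (hF : MemHardy F) {f : (Fin n → ℝ) → ℂ} (hf : MemLp f 2 volume) :
    IsBoundaryValue F f ↔ Tendsto (sliceLp F) (𝓝[octant n] 0) (𝓝 hf.toLp) := by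
  rw [Lp.tendsto_Lp_iff_tendsto_eLpNorm']
  simp only [IsBoundaryValue, hf, true_and]
  refine tendsto_congr' ?_
  filter_upwards [self_mem_nhdsWithin] with y hy
  rw [hF.sliceLp_eq hy]
  refine eLpNorm_congr_ae ?_
  filter_upwards [(hF.memLp_slice hy).coeFn_toLp, hf.coeFn_toLp] with x h1 h2
  simp [h1, h2]

theorem isBoundaryValue_boundaryValue (hF : MemHardy F) : IsBoundaryValue F (boundaryValue F) := by
  have h : ∃ f, IsBoundaryValue F f := by
    obtain ⟨f, hf⟩ := hF.exists_tendsto_sliceLp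
    refine ⟨f, (hF.isBoundaryValue_iff (Lp.memLp f)).2 ?_⟩
    rwa [Lp.toLp_coeFn]
  rw [boundaryValue, dif_pos h]
  exact h.choose_spec

/-- The boundary value of a Hardy function as an element of `L²`. -/
noncomputable def bdry (hF : MemHardy F) : Lp ℂ 2 (volume : Measure (Fin n → ℝ)) :=
  hF.isBoundaryValue_boundaryValue.1.toLp

theorem tendsto_sliceLp (hF : MemHardy F) : Tendsto (sliceLp F) (𝓝[octant n] 0) (𝓝 hF.bdry) :=
  (hF.isBoundaryValue_iff _).1 hF.isBoundaryValue_boundaryValue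

theorem norm_sliceLp_le (hF : MemHardy F) {y : Fin n → ℝ} (hy : y ∈ octant n) :
    ‖sliceLp F y‖ ≤ ‖hF.bdry‖ := by
  refine ge_of_tendsto hF.tendsto_sliceLp.norm ?_
  filter_upwards [eventually_le_octant hy, self_mem_nhdsWithin] with η h1 h2
  exact hF.norm_sliceLp_antitone h2 h1

/-- Slice norms increase as the height tends to `0`, so their supremum is their limit. This
transfers every norm question to the Hilbert space `L²`. -/
theorem normSq_eq (hF : MemHardy F) : normSq F = ENNReal.ofReal (‖hF.bdry‖ ^ 2) := by
  refine le_antisymm (iSup₂_le fun y hy => ?_) ?_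
  · rw [← hF.norm_sliceLp_sq hy]
    have := hF.norm_sliceLp_le hy
    gcongr
  · rw [ENNReal.ofReal_le_iff_le_toReal hF.2.ne]
    refine le_of_tendsto (hF.tendsto_sliceLp.norm.pow 2) ?_
    filter_upwards [self_mem_nhdsWithin] with η h
    exact hF.norm_sliceLp_sq_le h

theorem hardyInner_eq (hF : MemHardy F) (hG : MemHardy G) :
    hardyInner F G = inner ℂ hG.bdry hF.bdry :=
  (inner_toLp _ _).symm

theorem add (hF : MemHardy F) (hG : MemHardy G) : MemHardy (F + G) := by
  refine ⟨hF.1.add hG.1, ?_⟩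
  have hlt : (ENNReal.ofReal ((‖hF.bdry‖ + ‖hG.bdry‖) ^ 2)) < ⊤ := ENNReal.ofReal_lt_top
  refine lt_of_le_of_lt (iSup₂_le fun y hy => ?_) hlt
  have h1 := hF.memLp_slice hy
  have h2 := hG.memLp_slice hy
  have h3 := lintegral_enorm_sq_toLp (h1.add h2)
  refine le_of_eq_of_le h3 ?_
  rw [MemLp.toLp_add h1 h2, ← hF.sliceLp_eq hy, ← hG.sliceLp_eq hy]
  have := hF.norm_sliceLp_le hy
  have := hG.norm_sliceLp_le hy
  gcongr
  exact (norm_add_le _ _).trans (by gcongr)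

theorem const_smul (hF : MemHardy F) (c : ℂ) : MemHardy (c • F) := by
  refine ⟨hF.1.const_smul c, ?_⟩
  have hlt : (ENNReal.ofReal ((‖c‖ * ‖hF.bdry‖) ^ 2)) < ⊤ := ENNReal.ofReal_lt_top
  refine lt_of_le_of_lt (iSup₂_le fun y hy => ?_) hlt
  refine le_of_eq_of_le (lintegral_enorm_sq_toLp ((hF.memLp_slice hy).const_smul c)) ?_
  rw [MemLp.toLp_const_smul c (hF.memLp_slice hy), ← hF.sliceLp_eq hy, norm_smul]
  have := hF.norm_sliceLp_le hy
  gcongr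

end MemHardy

theorem memHardy_zero : MemHardy (0 : (Fin n → ℂ) → ℂ) := by
  refine ⟨differentiableOn_const 0, ?_⟩
  simp [normSq]

variable (n) in
/-- The Hardy space as a space of functions. -/
def hardySpace : Submodule ℂ ((Fin n → ℂ) → ℂ) where
  carrier := {F | MemHardy F}
  add_mem' := MemHardy.add
  zero_mem' := memHardy_zero
  smul_mem' c _ hF := hF.const_smul c

/-- The boundary value as a linear map from the Hardy space to `L²`. -/
noncomputable def bdryMap : hardySpace n →ₗ[ℂ] Lp ℂ 2 (volume : Measure (Fin n → ℝ)) where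
  toFun F := MemHardy.bdry F.2
  map_add' F G := by
    have hF : MemHardy (F : (Fin n → ℂ) → ℂ) := F.2
    have hG : MemHardy (G : (Fin n → ℂ) → ℂ) := G.2
    refine tendsto_nhds_unique (hF.add hG).tendsto_sliceLp
      ((hF.tendsto_sliceLp.add hG.tendsto_sliceLp).congr' ?_)
    filter_upwards [self_mem_nhdsWithin] with y hy
    rw [hF.sliceLp_eq hy, hG.sliceLp_eq hy, (hF.add hG).sliceLp_eq hy]
    rfl
  map_smul' c F := by
    have hF : MemHardy (F : (Fin n → ℂ) → ℂ) := F.2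
    refine tendsto_nhds_unique (hF.const_smul c).tendsto_sliceLp
      ((hF.tendsto_sliceLp.const_smul c).congr' ?_)
    filter_upwards [self_mem_nhdsWithin] with y hy
    rw [hF.sliceLp_eq hy, (hF.const_smul c).sliceLp_eq hy]
    rfl

theorem normSq_coe (F : hardySpace n) :
    normSq (F : (Fin n → ℂ) → ℂ) = ENNReal.ofReal (‖bdryMap F‖ ^ 2) :=
  MemHardy.normSq_eq F.2

theorem hardyInner_coe (F G : hardySpace n) :
    hardyInner (F : (Fin n → ℂ) → ℂ) G = inner ℂ (bdryMap G) (bdryMap F) :=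
  MemHardy.hardyInner_eq F.2 G.2

end HardyTube

/-! ### Mean values in several variables and bounded point evaluations. -/

namespace HardyTube

open scoped ENNReal

/-- A representation formula in one variable, valid for bounded holomorphic functions on `U`,
extends to functions of several variables on `Uⁿ`. -/
theorem integral_pi_mul_prod_eq {X : Type*} [MeasurableSpace X] {μ : Measure X} [SigmaFinite μ]
    {U : Set ℂ} {e : X → ℂ} (he : Measurable e) (heU : ∀ᵐ x ∂μ, e x ∈ U) :
    ∀ (n : ℕ) (ρ : Fin n → X → ℂ) (c : Fin n → ℂ), (∀ k, c k ∈ U) → (∀ k, Integrable (ρ k) μ) →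
      (∀ k, ∀ g : ℂ → ℂ, Measurable g → DifferentiableOn ℂ g U → (∃ C, ∀ w, ‖g w‖ ≤ C) →
        ∫ x, g (e x) * ρ k x ∂μ = g (c k)) →
      ∀ G : (Fin n → ℂ) → ℂ, Measurable G → DifferentiableOn ℂ G (Set.univ.pi fun _ => U) →
        (∃ C, ∀ w, ‖G w‖ ≤ C) →
        ∫ x, G (fun k => e (x k)) * ∏ k, ρ k (x k) ∂(Measure.pi fun _ => μ) = G c := by
  intro n
  induction n with
  | zero =>
    intro ρ c _ _ _ G _ _ _
    rw [Measure.pi_of_empty (fun _ : Fin 0 => μ) (fun k => k.elim0), integral_dirac]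
    simp only [Finset.univ_eq_empty, Finset.prod_empty, mul_one]
    congr 1
    exact Subsingleton.elim _ _
  | succ n ih =>
    intro ρ c hc hρ h1 G hG hGd hGb
    obtain ⟨C, hC⟩ := hGb
    set Ψ : X × (Fin n → X) → ℂ := fun p =>
      G (Fin.cons (e p.1) fun j => e (p.2 j)) * (ρ 0 p.1 * ∏ j, ρ (Fin.succ j) (p.2 j)) with hΨ
    have hcons : Measurable fun p : ℂ × (Fin n → ℂ) => (Fin.cons p.1 p.2 : Fin (n + 1) → ℂ) := by
      refine measurable_pi_iff.2 fun j => ?_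
      refine Fin.cases ?_ (fun j => ?_) j
      · simpa using measurable_fst
      · simp only [Fin.cons_succ]; fun_prop
    have hint : Integrable Ψ (μ.prod (Measure.pi fun _ => μ)) := by
      -- Boundedness of `G` and integrability of every weight justify Fubini, which splits off the
      -- first variable for the induction.
      refine Integrable.bdd_mul (c := C) ((hρ 0).mul_prod
        (Integrable.fintype_prod fun j => hρ (Fin.succ j))) ?_ (Eventually.of_forall fun p => hC _)
      exact (hG.comp (hcons.comp (by fun_prop :
        Measurable fun p : X × (Fin n → X) => (e p.1, fun j => e (p.2 j))))).aestronglyMeasurable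
    have hmp := measurePreserving_piFinSuccAbove (fun _ : Fin (n + 1) => μ) 0
    have hstep : ∫ x, G (fun k => e (x k)) * ∏ k, ρ k (x k) ∂(Measure.pi fun _ => μ) =
        ∫ p, Ψ p ∂(μ.prod (Measure.pi fun _ => μ)) := by
      rw [← hmp.integral_comp (MeasurableEquiv.measurableEmbedding _)]
      refine integral_congr_ae (Eventually.of_forall fun x => ?_)
      simp only [hΨ, MeasurableEquiv.piFinSuccAbove_apply]
      rw [Fin.prod_univ_succ]
      congr 2
      ext k
      refine Fin.cases ?_ (fun j => ?_) k <;> simp [Fin.tail]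
    rw [hstep, integral_prod _ hint]
    have hinner : ∀ a, e a ∈ U → ∫ v, Ψ (a, v) ∂(Measure.pi fun _ => μ) =
        G (Fin.cons (e a) fun j => c (Fin.succ j)) * ρ 0 a := by
      intro a ha
      have := ih (fun j => ρ (Fin.succ j)) (fun j => c (Fin.succ j)) (fun j => hc _)
        (fun j => hρ _) (fun j => h1 _) (fun v => G (Fin.cons (e a) v))
        (hG.comp (hcons.comp (measurable_const.prodMk measurable_id))) ?_ ⟨C, fun w => hC _⟩
      · rw [← this, ← integral_mul_const]
        refine integral_congr_ae (Eventually.of_forall fun v => ?_)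
        simp only [hΨ]; ring
      · refine hGd.comp (f := fun v : Fin n → ℂ => (Fin.cons (e a) v : Fin (n + 1) → ℂ)) ?_ ?_
        · refine differentiableOn_pi.2 fun j => ?_
          refine Fin.cases ?_ (fun j => ?_) j
          · simp
          · simp only [Fin.cons_succ]; fun_prop
        · intro v hv j _
          refine Fin.cases ?_ (fun j => ?_) j
          · simpa using ha
          · simpa using hv j trivial
    have hae : ∫ a, ∫ v, Ψ (a, v) ∂(Measure.pi fun _ => μ) ∂μ =
        ∫ a, G (Fin.cons (e a) fun j => c (Fin.succ j)) * ρ 0 a ∂μ :=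
      integral_congr_ae (heU.mono fun a ha => hinner a ha)
    rw [hae, h1 0 (fun w => G (Fin.cons w fun j => c (Fin.succ j)))
      (hG.comp (hcons.comp (measurable_id.prodMk measurable_const))) ?_ ⟨C, fun w => hC _⟩]
    · congr 1
      ext k
      refine Fin.cases ?_ (fun j => ?_) k <;> simp
    · refine hGd.comp
        (f := fun w : ℂ => (Fin.cons w fun j => c (Fin.succ j) : Fin (n + 1) → ℂ)) ?_ ?_
      · refine differentiableOn_pi.2 fun j => ?_
        refine Fin.cases ?_ (fun j => ?_) j
        · simp only [Fin.cons_zero]; fun_prop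
        · simp
      · intro v hv j _
        refine Fin.cases ?_ (fun j => ?_) j
        · simpa using hv
        · simpa using hc _

/-- The mean value property over discs. -/
theorem setIntegral_ball_eq {r : ℝ} {g : ℂ → ℂ} (hgm : Measurable g)
    (hg : DifferentiableOn ℂ g (Metric.ball 0 r)) (hb : ∃ C, ∀ w, ‖g w‖ ≤ C) :
    ∫ w in Metric.ball (0 : ℂ) r, g w = (volume (Metric.ball (0 : ℂ) r)).toReal * g 0 := by
  obtain ⟨C, hC⟩ := hb
  set μ := (volume : Measure ℂ).restrict (Metric.ball (0 : ℂ) r) with hμ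
  have hfin : IsFiniteMeasure μ := ⟨by
    rw [hμ, Measure.restrict_apply_univ]; exact Metric.isBounded_ball.measure_lt_top⟩
  -- The disc integral is invariant under rotations. Averaging over the angle and exchanging the
  -- integrals replaces `g w` by its circle mean, which is `g 0`.
  have hrot : ∀ θ : ℝ, ∫ w, g (circleMap 0 1 θ * w) ∂μ = ∫ w, g w ∂μ := by
    intro θ
    have hmp : MeasurePreserving (rotation (Circle.exp θ)) (volume : Measure ℂ) volume :=
      LinearIsometryEquiv.measurePreserving _
    have := hmp.setIntegral_preimage_emb
      (rotation (Circle.exp θ)).toHomeomorph.measurableEmbedding g (Metric.ball 0 r)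
    rw [hμ, ← this]
    have hpre : (rotation (Circle.exp θ)) ⁻¹' Metric.ball (0 : ℂ) r = Metric.ball 0 r := by
      ext w
      simp only [Set.mem_preimage, mem_ball_zero_iff, LinearIsometryEquiv.norm_map]
    rw [hpre]
    refine setIntegral_congr_fun Metric.isOpen_ball.measurableSet fun w _ => ?_
    simp [circleMap, rotation_apply, Circle.coe_exp]
  have hint : Integrable (Function.uncurry fun (θ : ℝ) (w : ℂ) => g (circleMap 0 1 θ * w))
      ((volume.restrict (Set.uIoc 0 (2 * Real.pi))).prod μ) := by
    have : IsFiniteMeasure ((volume : Measure ℝ).restrict (Set.uIoc 0 (2 * Real.pi))) :=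
      ⟨by simp [Set.uIoc]⟩
    refine Integrable.of_bound (C := C) ?_ (Eventually.of_forall fun p => hC _)
    exact (hgm.comp (by fun_prop :
      Measurable fun p : ℝ × ℂ => circleMap 0 1 p.1 * p.2)).aestronglyMeasurable
  have hswap := intervalIntegral_integral_swap hint
  simp only [hrot] at hswap
  have hmean : ∀ᵐ w ∂μ, ∫ θ in (0 : ℝ)..(2 * Real.pi), g (circleMap 0 1 θ * w) =
      (2 * Real.pi : ℝ) • g 0 := by
    refine (ae_restrict_iff' Metric.isOpen_ball.measurableSet).2 (Eventually.of_forall fun w hw => ?_)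
    have hw' : ‖w‖ < r := by simpa using hw
    have h1 : DiffContOnCl ℂ g (Metric.ball 0 |‖w‖|) := by
      rw [abs_norm]
      exact (hg.mono (Metric.closedBall_subset_ball hw')).diffContOnCl_ball le_rfl
    have h2 := h1.circleAverage
    rw [Real.circleAverage_eq_integral_add (Complex.arg w)] at h2
    rw [← h2, smul_inv_smul₀ (by positivity)]
    refine intervalIntegral.integral_congr fun θ _ => ?_
    simp only [circleMap, zero_add, Complex.ofReal_one, one_mul, Complex.ofReal_add, add_mul,
      Complex.exp_add]
    congr 1
    rw [mul_left_comm, Complex.norm_mul_exp_arg_mul_I]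
  rw [integral_congr_ae hmean, intervalIntegral.integral_const, integral_const, sub_zero,
    smul_comm, smul_right_inj (by positivity)] at hswap
  rw [hswap, hμ, measureReal_def, Measure.restrict_apply_univ]
  simp

variable {n : ℕ} {F : (Fin n → ℂ) → ℂ}

/-- Point evaluations are bounded by the Hardy norm, uniformly for points whose closed polydisc of
radius `r` is contained in the tube. -/
theorem exists_norm_sq_le_normSq (n : ℕ) {r : ℝ} (hr : 0 < r) :
    ∃ C : ℝ, ∀ F : (Fin n → ℂ) → ℂ, MemHardy F → ∀ z, Metric.closedBall z r ⊆ tube n →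
      ‖F z‖ ^ 2 ≤ C * (normSq F).toReal := by
  classical
  set B := Metric.ball (0 : ℂ) r with hB
  set μ := (volume : Measure ℂ).restrict B with hμ
  set v := (volume B).toReal with hv
  have hvt : volume B ≠ ⊤ := Metric.isBounded_ball.measure_lt_top.ne
  have hv0 : 0 < v := ENNReal.toReal_pos (Metric.measure_ball_pos _ _ hr).ne' hvt
  have hfin : IsFiniteMeasure μ := ⟨by
    rw [hμ, Measure.restrict_apply_univ]; exact hvt.lt_top⟩
  refine ⟨(2 * r) ^ n * (v⁻¹) ^ n, fun F hF z hz => ?_⟩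
  have hsub : ∀ w ∈ Set.univ.pi (fun _ : Fin n => B), z + w ∈ Metric.closedBall z r := by
    intro w hw
    rw [Metric.mem_closedBall, dist_self_add_left, pi_norm_le_iff_of_nonneg hr.le]
    intro j
    have := hw j trivial
    simp only [hB, mem_ball_zero_iff] at this
    exact this.le
  have hopen : IsOpen (Set.univ.pi (fun _ : Fin n => B)) :=
    isOpen_set_pi Set.finite_univ fun _ _ => Metric.isOpen_ball
  set P := Set.univ.pi (fun _ : Fin n => B) with hP
  have hmaps : Set.MapsTo (fun w => z + w) P (tube n) := fun w hw => hz (hsub w hw)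
  have hd : DifferentiableOn ℂ (fun w => F (z + w)) P :=
    hF.1.comp (f := fun w => z + w) (by fun_prop) hmaps
  -- the mean value property in several variables, for the square of `F`
  set G : (Fin n → ℂ) → ℂ := P.indicator fun w => F (z + w) ^ 2 with hG
  have hGm : Measurable G := by
    rw [hG, ← Set.piecewise_eq_indicator]
    exact (hd.continuousOn.pow 2).measurable_piecewise continuousOn_const hopen.measurableSet
  have hGd : DifferentiableOn ℂ G P :=
    (hd.pow 2).congr fun w hw => Set.indicator_of_mem hw _
  have hGb : ∃ C, ∀ w, ‖G w‖ ≤ C := by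
    obtain ⟨C, hC⟩ := (isCompact_closedBall z r).exists_bound_of_continuousOn
      (hF.1.continuousOn.mono hz)
    refine ⟨C ^ 2, fun w => ?_⟩
    by_cases hw : w ∈ P
    · rw [hG, Set.indicator_of_mem hw, norm_pow]
      gcongr
      exact hC _ (hsub w hw)
    · rw [hG, Set.indicator_of_notMem hw, norm_zero]
      positivity
  have hmv := integral_pi_mul_prod_eq (μ := μ) (U := B) (e := id) measurable_id
    (ae_restrict_mem Metric.isOpen_ball.measurableSet) n (fun _ _ => ((v : ℂ))⁻¹) (fun _ => 0)
    (fun _ => Metric.mem_ball_self hr) (fun _ => integrable_const _)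
    (fun _ g hgm hgd hgb => by
      simp only [id]
      rw [integral_mul_const, setIntegral_ball_eq hgm hgd hgb, mul_right_comm, ← hB, ← hv,
        mul_inv_cancel₀ (by exact_mod_cast hv0.ne'), one_mul]) G hGm hGd hGb
  have h0 : (fun _ => 0 : Fin n → ℂ) ∈ P := fun _ _ => Metric.mem_ball_self hr
  simp only [id, Finset.prod_const, Finset.card_univ, Fintype.card_fin] at hmv
  rw [integral_mul_const] at hmv
  have hG0 : G (fun _ => 0) = F z ^ 2 := by
    rw [hG, Set.indicator_of_mem h0]
    congr 2; ext j; simp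
  rw [hG0] at hmv
  -- the integral of `|F|²` over the polydisc
  have hpi : (Measure.pi fun _ : Fin n => μ) = (volume : Measure (Fin n → ℂ)).restrict P := by
    rw [hμ, volume_pi, Measure.restrict_pi_pi]
  have hle : ∫⁻ w, ‖G w‖ₑ ∂(Measure.pi fun _ : Fin n => μ) ≤
      ENNReal.ofReal ((2 * r) ^ n) * normSq F := by
    set x₀ : Fin n → ℝ := fun j => (z j).re with hx₀
    set y₀ : Fin n → ℝ := fun j => (z j).im with hy₀
    set Q : Set (Fin n → ℝ) := Set.univ.pi fun _ => Set.Ioo (-r) r with hQ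
    set Ey : MeasurableEquiv (Fin n → ℂ) ((Fin n → ℝ) × (Fin n → ℝ)) :=
      (MeasurableEquiv.piCongrRight fun _ => Complex.measurableEquivRealProd).trans
        (MeasurableEquiv.arrowProdEquivProdArrow ℝ ℝ (Fin n)) with hEy
    have hmp : MeasurePreserving Ey volume volume :=
      MeasurePreserving.trans
        (volume_preserving_pi fun _ => Complex.volume_preserving_equiv_real_prod)
        (volume_measurePreserving_arrowProdEquivProdArrow ℝ ℝ (Fin n))
    have hEapp : ∀ w, Ey w = (fun j => (w j).re, fun j => (w j).im) := fun w => rfl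
    -- The polydisc is enlarged to a full strip in the real directions. Each horizontal slice then
    -- contributes at most `normSq F`, and the cube `Q` of heights has volume `(2r)^n`.
    set S : (Fin n → ℝ) × (Fin n → ℝ) → ℝ≥0∞ :=
      (Set.univ ×ˢ Q).indicator fun p => ‖F (pt (p.1 + x₀) (y₀ + p.2))‖ₑ ^ 2 with hS
    have hQo : IsOpen Q := isOpen_set_pi Set.finite_univ fun _ _ => isOpen_Ioo
    have hy₀Q : ∀ t ∈ Q, y₀ + t ∈ octant n := by
      intro t ht
      have : z + pt 0 t ∈ Metric.closedBall z r := by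
        rw [Metric.mem_closedBall, dist_self_add_left, pi_norm_le_iff_of_nonneg hr.le]
        intro j
        have := ht j trivial
        simpa [pt] using (abs_lt.2 this).le
      have h2 := hz this
      intro j
      simpa [pt] using h2 j
    have hSm : Measurable S := by
      rw [hS, ← Set.piecewise_eq_indicator]
      have : ContinuousOn (fun p : (Fin n → ℝ) × (Fin n → ℝ) => F (pt (p.1 + x₀) (y₀ + p.2)))
          (Set.univ ×ˢ Q) := by
        refine hF.1.continuousOn.comp
          (f := fun p : (Fin n → ℝ) × (Fin n → ℝ) => pt (p.1 + x₀) (y₀ + p.2))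
          (continuous_pt.comp (by fun_prop : Continuous fun p : (Fin n → ℝ) × (Fin n → ℝ) =>
            (p.1 + x₀, y₀ + p.2))).continuousOn ?_
        rintro ⟨x, t⟩ ⟨-, ht⟩
        exact pt_mem_tube.2 (hy₀Q t ht)
      have h2 : ContinuousOn (fun p : (Fin n → ℝ) × (Fin n → ℝ) =>
          ‖F (pt (p.1 + x₀) (y₀ + p.2))‖ₑ ^ 2) (Set.univ ×ˢ Q) :=
        (ENNReal.continuous_pow 2).comp_continuousOn (continuous_enorm.comp_continuousOn this)
      exact h2.measurable_piecewise continuousOn_const (isOpen_univ.prod hQo).measurableSet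
    calc ∫⁻ w, ‖G w‖ₑ ∂(Measure.pi fun _ : Fin n => μ)
        ≤ ∫⁻ w, S (Ey w) := by
          rw [hpi, ← lintegral_indicator hopen.measurableSet]
          refine lintegral_mono fun w => ?_
          by_cases hw : w ∈ P
          · rw [Set.indicator_of_mem hw, hG, Set.indicator_of_mem hw, hEapp, hS,
              Set.indicator_of_mem]
            · rw [enorm_pow]
              refine le_of_eq ?_
              congr 3
              ext j
              simp only [Pi.add_apply, pt, x₀, y₀]
              apply Complex.ext <;> simp [add_comm]
            · refine ⟨trivial, fun j _ => ?_⟩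
              have := hw j trivial
              simp only [hB, mem_ball_zero_iff] at this
              exact abs_lt.1 ((Complex.abs_im_le_norm _).trans_lt this)
          · rw [Set.indicator_of_notMem hw]; exact zero_le
      _ = ∫⁻ p, S p := hmp.lintegral_comp hSm
      _ = ∫⁻ t, ∫⁻ x, S (x, t) := by
          rw [Measure.volume_eq_prod, lintegral_prod_symm' _ hSm]
      _ ≤ ∫⁻ t, Q.indicator (fun _ => normSq F) t := by
          refine lintegral_mono fun t => ?_
          by_cases ht : t ∈ Q
          · rw [Set.indicator_of_mem ht]
            have : ∀ x, S (x, t) = ‖F (pt (x + x₀) (y₀ + t))‖ₑ ^ 2 := fun x => by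
              rw [hS, Set.indicator_of_mem (show (x, t) ∈ Set.univ ×ˢ Q from ⟨trivial, ht⟩)]
            simp_rw [this]
            rw [lintegral_add_right_eq_self fun x => ‖F (pt x (y₀ + t))‖ₑ ^ 2]
            exact MemHardy.lintegral_slice_le (hy₀Q t ht)
          · rw [Set.indicator_of_notMem ht]
            have : ∀ x, S (x, t) = 0 := fun x => by
              rw [hS, Set.indicator_of_notMem fun h => ht h.2]
            simp [this]
      _ = ENNReal.ofReal ((2 * r) ^ n) * normSq F := by
          rw [lintegral_indicator_const hQo.measurableSet, hQ, Real.volume_pi_Ioo]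
          rw [mul_comm]
          congr 1
          simp only [sub_neg_eq_add, Finset.prod_const, Finset.card_univ, Fintype.card_fin]
          rw [← two_mul, ENNReal.ofReal_pow (by positivity)]
  have hI : ‖∫ w, G w ∂(Measure.pi fun _ : Fin n => μ)‖ ≤ (2 * r) ^ n * (normSq F).toReal := by
    have h3 := (enorm_integral_le_lintegral_enorm G).trans hle
    rw [← ofReal_norm, ← ENNReal.ofReal_toReal hF.2.ne, ← ENNReal.ofReal_mul (by positivity),
      ENNReal.ofReal_le_ofReal_iff (by positivity)] at h3
    simpa using h3
  calc ‖F z‖ ^ 2 = ‖F z ^ 2‖ := (norm_pow _ _).symm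
    _ = ‖∫ w, G w ∂(Measure.pi fun _ : Fin n => μ)‖ * (v⁻¹) ^ n := by
        rw [← hmv, norm_mul, norm_pow, norm_inv, Complex.norm_real, Real.norm_of_nonneg hv0.le]
    _ ≤ ((2 * r) ^ n * (normSq F).toReal) * (v⁻¹) ^ n := by gcongr
    _ = _ := by ring

end HardyTube

/-! ### Poisson and damped Cauchy formulas in one variable. -/

namespace HardyTube

open scoped ENNReal ComplexConjugate

theorem mul_sub_conj (ξ : ℝ) (c : ℂ) :
    ((ξ : ℂ) - c) * ((ξ : ℂ) - conj c) = (((ξ - c.re) ^ 2 + c.im ^ 2 : ℝ) : ℂ) := by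
  apply Complex.ext
  · rw [Complex.ofReal_re]; simp; ring
  · rw [Complex.ofReal_im]; simp; ring

theorem integrable_inv_sq_add_sq (a : ℝ) {b : ℝ} (hb : 0 < b) :
    Integrable fun ξ : ℝ => ((ξ - a) ^ 2 + b ^ 2)⁻¹ := by
  lift b to NNReal using hb.le
  have h := (ProbabilityTheory.integrable_cauchyPDFReal a (γ := b)).const_mul (Real.pi / b)
  refine h.congr (Eventually.of_forall fun ξ => ?_)
  simp only [ProbabilityTheory.cauchyPDFReal_def]
  have := Real.pi_pos
  field_simp

theorem integral_inv_sq_add_sq (a : ℝ) {b : ℝ} (hb : 0 < b) :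
    ∫ ξ : ℝ, ((ξ - a) ^ 2 + b ^ 2)⁻¹ = Real.pi / b := by
  lift b to NNReal using hb.le
  have h := ProbabilityTheory.integral_cauchyPDFReal_eq_one a (γ := b) (by exact_mod_cast hb.ne')
  simp only [ProbabilityTheory.cauchyPDFReal_def] at h
  rw [integral_const_mul] at h
  have := Real.pi_pos
  field_simp at h ⊢
  linarith

theorem integrable_inv_mul_sub_conj {c : ℂ} (hc : 0 < c.im) :
    Integrable fun ξ : ℝ => (((ξ : ℂ) - c) * ((ξ : ℂ) - conj c))⁻¹ := by
  refine (integrable_inv_sq_add_sq c.re hc).ofReal (𝕜 := ℂ) |>.congr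
    (Eventually.of_forall fun ξ => ?_)
  simp only [mul_sub_conj]
  simp

/-- The Poisson formula for bounded holomorphic functions in a neighbourhood of the closed upper
half plane. -/
theorem integral_poisson {ε : ℝ} (hε : 0 < ε) {c : ℂ} (hc : 0 < c.im) {g : ℂ → ℂ}
    (hg : DifferentiableOn ℂ g {w | -ε < w.im}) {C : ℝ} (hC : ∀ w ∈ {w : ℂ | -ε < w.im}, ‖g w‖ ≤ C) :
    ∫ ξ : ℝ, g ξ * (((ξ : ℂ) - c) * ((ξ : ℂ) - conj c))⁻¹ = g c * (Real.pi / c.im) := by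
  have hUo : IsOpen {w : ℂ | -ε < w.im} := isOpen_lt continuous_const Complex.continuous_im
  have hcU : c ∈ {w : ℂ | -ε < w.im} := by simp only [Set.mem_ofPred_eq]; linarith
  have hC0 : 0 ≤ C := (norm_nonneg _).trans (hC c hcU)
  have hreal : ∀ ξ : ℝ, (ξ : ℂ) ∈ {w : ℂ | -ε < w.im} := fun ξ => by simp [hε]
  -- This is `(g w - g c) / ((w - c)(w - conj c))` with the singularity at `c` removed. It is
  -- holomorphic on the closed upper half plane and decays quadratically, so its integral over the
  -- real line vanishes; what remains is the integral of the Poisson kernel.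
  set k : ℂ → ℂ := fun w => dslope g c w * (w - conj c)⁻¹ with hk
  have hne : ∀ w : ℂ, 0 ≤ w.im → w - conj c ≠ 0 := by
    intro w hw h
    have := congrArg Complex.im h
    simp at this
    linarith
  have hkd : DifferentiableOn ℂ k {w | 0 ≤ w.im} := by
    refine DifferentiableOn.mul ?_ ?_
    · refine ((Complex.differentiableOn_dslope (hUo.mem_nhds hcU)).2 hg).mono fun w hw => ?_
      simp only [Set.mem_ofPred_eq] at hw ⊢
      linarith
    · exact DifferentiableOn.inv (by fun_prop) fun w hw => hne w hw
  have hkbound : ∀ w : ℂ, 0 ≤ w.im → ∀ R : ℝ, 0 < R → R ≤ ‖w - c‖ → R ≤ ‖w - conj c‖ →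
      ‖k w‖ ≤ 2 * C / R ^ 2 := by
    intro w hw R hR h1 h2
    have hwc : w ≠ c := by
      rintro rfl
      simp at h1
      linarith
    have hwU : w ∈ {w : ℂ | -ε < w.im} := by simp only [Set.mem_ofPred_eq]; linarith
    simp only [hk]
    rw [dslope_of_ne _ hwc, slope_def_module, norm_mul, norm_smul, norm_inv, norm_inv]
    calc ‖w - c‖⁻¹ * ‖g w - g c‖ * ‖w - conj c‖⁻¹ ≤ R⁻¹ * (C + C) * R⁻¹ := by
          gcongr
          exact (norm_sub_le _ _).trans (add_le_add (hC w hwU) (hC c hcU))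
      _ = 2 * C / R ^ 2 := by field_simp; ring
  have hkreal : ∀ ξ : ℝ, k ξ = (g ξ - g c) * (((ξ : ℂ) - c) * ((ξ : ℂ) - conj c))⁻¹ := by
    intro ξ
    have hξc : (ξ : ℂ) ≠ c := by
      rintro rfl
      simp at hc
    simp only [hk]
    rw [dslope_of_ne _ hξc, slope_def_module, smul_eq_mul, mul_inv]
    ring
  have hgc : Continuous fun ξ : ℝ => g ξ :=
    hg.continuousOn.comp_continuous Complex.continuous_ofReal hreal
  have hP := integrable_inv_mul_sub_conj hc
  have hgint : Integrable fun ξ : ℝ => g ξ * (((ξ : ℂ) - c) * ((ξ : ℂ) - conj c))⁻¹ :=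
    hP.bdd_mul hgc.aestronglyMeasurable (Eventually.of_forall fun ξ => hC _ (hreal ξ))
  have hkint : Integrable fun ξ : ℝ => k ξ := by
    refine (hgint.sub (hP.const_mul (g c))).congr (Eventually.of_forall fun ξ => ?_)
    simp only [hkreal, Pi.sub_apply]
    ring
  have hlim := intervalIntegral_tendsto_integral (a := fun R : ℝ => c.re - R)
    (b := fun R : ℝ => c.re + R) (l := atTop) hkint
    (tendsto_atBot_add_const_left _ _ tendsto_neg_atTop_atBot)
    (tendsto_atTop_add_const_left _ _ tendsto_id)
  have hzero : Tendsto (fun R : ℝ => ∫ ξ in (c.re - R)..(c.re + R), k ξ) atTop (𝓝 0) := by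
    have hbound : ∀ R : ℝ, 1 ≤ R → ‖∫ ξ in (c.re - R)..(c.re + R), k ξ‖ ≤
        (8 * C + 4 * C * c.im) * R⁻¹ := by
      intro R hR
      have hR0 : 0 < R := by linarith
      have hrect := Complex.integral_boundary_rect_eq_zero_of_differentiableOn k
        ((c.re - R : ℝ) : ℂ) (((c.re + R : ℝ) : ℂ) + ((c.im + R : ℝ) : ℂ) * Complex.I)
        (hkd.mono (by
          intro ζ hζ
          have := hζ.2
          simp only [Set.mem_preimage, Complex.ofReal_im, Complex.add_im, Complex.mul_im,
            Complex.ofReal_re, Complex.I_im, mul_one, Complex.I_re, mul_zero, add_zero,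
            zero_add] at this
          rw [Set.uIcc_of_le (by linarith)] at this
          exact this.1))
      simp only [Complex.ofReal_im, Complex.add_im, Complex.mul_im, Complex.add_re, Complex.mul_re,
            Complex.ofReal_re, Complex.I_im, mul_one, Complex.I_re, mul_zero, add_zero, sub_zero,
            zero_add, Complex.ofReal_zero, zero_mul, smul_eq_mul] at hrect
      have htop : ‖∫ x in (c.re - R)..(c.re + R), k (x + ((c.im + R : ℝ) : ℂ) * Complex.I)‖ ≤
          2 * C / R ^ 2 * |c.re + R - (c.re - R)| := by
        refine intervalIntegral.norm_integral_le_of_norm_le_const fun x _ => ?_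
        refine hkbound _ (by simp; linarith) R hR0 ?_ ?_
        · refine le_trans ?_ (Complex.abs_im_le_norm _)
          simp [abs_of_pos hR0]
        · refine le_trans ?_ (Complex.abs_im_le_norm _)
          simp only [Complex.sub_im, Complex.add_im, Complex.ofReal_im, Complex.mul_im,
            Complex.ofReal_re, Complex.I_im, mul_one, Complex.I_re, mul_zero, add_zero, zero_add,
            Complex.conj_im]
          rw [abs_of_pos (by linarith)]; linarith
      have hside : ∀ s : ℝ, |s| = R →
          ‖∫ y in (0 : ℝ)..(c.im + R), k (((c.re + s : ℝ) : ℂ) + y * Complex.I)‖ ≤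
          2 * C / R ^ 2 * |c.im + R - 0| := by
        intro s hs
        refine intervalIntegral.norm_integral_le_of_norm_le_const fun y hy => ?_
        rw [Set.uIoc_of_le (by linarith)] at hy
        refine hkbound _ (by simpa using hy.1.le) R hR0 ?_ ?_
        · refine le_trans ?_ (Complex.abs_re_le_norm _)
          simp [hs]
        · refine le_trans ?_ (Complex.abs_re_le_norm _)
          simp [hs]
      have hr := hside R (abs_of_pos hR0)
      have hl := hside (-R) (by rw [abs_neg, abs_of_pos hR0])
      rw [← sub_eq_add_neg] at hl
      have hI : ‖Complex.I‖ = 1 := Complex.norm_I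
      have heq : ∫ ξ in (c.re - R)..(c.re + R), k ξ =
          (∫ x in (c.re - R)..(c.re + R), k (x + ((c.im + R : ℝ) : ℂ) * Complex.I)) -
          Complex.I * (∫ y in (0 : ℝ)..(c.im + R), k (((c.re + R : ℝ) : ℂ) + y * Complex.I)) +
          Complex.I * (∫ y in (0 : ℝ)..(c.im + R), k (((c.re - R : ℝ) : ℂ) + y * Complex.I)) := by
        linear_combination hrect
      rw [heq]
      refine (norm_add_le _ _).trans ((add_le_add_left (norm_sub_le _ _) _).trans ?_)
      rw [norm_mul, norm_mul, hI, one_mul, one_mul]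
      refine (add_le_add (add_le_add htop hr) hl).trans ?_
      rw [abs_of_pos (by linarith), abs_of_pos (by linarith)]
      have : 2 * C / R ^ 2 * (c.re + R - (c.re - R)) + 2 * C / R ^ 2 * (c.im + R - 0) +
          2 * C / R ^ 2 * (c.im + R - 0) = 8 * C * R⁻¹ + 4 * C * c.im * (R⁻¹ * R⁻¹) := by
        field_simp; ring
      rw [this, add_mul]
      have hRi : R⁻¹ ≤ 1 := inv_le_one_of_one_le₀ hR
      gcongr
      exact mul_le_of_le_one_left (by positivity) hRi
    refine squeeze_zero_norm' ((eventually_ge_atTop 1).mono fun R hR => hbound R hR) ?_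
    simpa using tendsto_inv_atTop_zero.const_mul (8 * C + 4 * C * c.im)
  have hk0 : ∫ ξ : ℝ, k ξ = 0 := tendsto_nhds_unique hlim hzero
  simp_rw [hkreal, sub_mul (g _)] at hk0
  rw [integral_sub hgint (hP.const_mul _), sub_eq_zero, integral_const_mul] at hk0
  rw [hk0]
  congr 1
  simp_rw [mul_sub_conj, ← Complex.ofReal_inv]
  rw [integral_complex_ofReal, integral_inv_sq_add_sq _ hc]
  push_cast
  rfl

/-- The Cauchy kernel with centre `c`, damped by a factor which is holomorphic in the upper
half plane. -/
noncomputable def dampedCauchy (δ : ℝ) (c : ℂ) (ξ : ℝ) : ℂ :=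
  (1 - Complex.I * δ * c) * (2 * Real.pi * Complex.I * (ξ - c) * (1 - Complex.I * δ * ξ))⁻¹

theorem half_le_re_damping {ε δ : ℝ} (hδ : 0 < δ) (hδε : δ * ε ≤ 1 / 2) {w : ℂ} (hw : -ε < w.im) :
    1 / 2 ≤ (1 - Complex.I * δ * w).re := by
  have : (1 - Complex.I * δ * w).re = 1 + δ * w.im := by simp
  rw [this]
  nlinarith

theorem damping_ne_zero {ε δ : ℝ} (hδ : 0 < δ) (hδε : δ * ε ≤ 1 / 2) {w : ℂ} (hw : -ε < w.im) :
    1 - Complex.I * δ * w ≠ 0 := by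
  intro h
  have := half_le_re_damping hδ hδε hw
  rw [h] at this
  norm_num at this

/-- A Möbius map is bounded away from its pole, and here the pole `-i/δ` lies well below the half
plane `Im w > -ε`. -/
theorem exists_norm_damped_le {ε δ : ℝ} (hδ : 0 < δ) (hδε : δ * ε ≤ 1 / 2) (c : ℂ) :
    ∃ C : ℝ, ∀ w : ℂ, -ε < w.im → ‖(w - conj c) * (1 - Complex.I * δ * w)⁻¹‖ ≤ C := by
  refine ⟨δ⁻¹ * (1 + ‖1 - Complex.I * δ * conj c‖ * 2), fun w hw => ?_⟩
  have h0 := damping_ne_zero hδ hδε hw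
  have hδ' : (δ : ℂ) ≠ 0 := by exact_mod_cast hδ.ne'
  have heq : (w - conj c) * (1 - Complex.I * δ * w)⁻¹ = Complex.I * (δ : ℂ)⁻¹ *
      (1 - (1 - Complex.I * δ * conj c) * (1 - Complex.I * δ * w)⁻¹) := by
    have hq := mul_inv_cancel₀ h0
    have hd := inv_mul_cancel₀ hδ'
    set p := (1 - Complex.I * δ * w)⁻¹
    set d := (δ : ℂ)⁻¹
    linear_combination Complex.I * d * hq + (w - conj c) * p * d * δ * Complex.I_sq -
      (w - conj c) * p * hd
  rw [heq, norm_mul, norm_mul, Complex.norm_I, one_mul, norm_inv, Complex.norm_real,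
    Real.norm_of_nonneg hδ.le]
  gcongr
  refine (norm_sub_le _ _).trans ?_
  rw [norm_one, norm_mul]
  gcongr
  rw [norm_inv]
  have : 1 / 2 ≤ ‖1 - Complex.I * δ * w‖ :=
    (half_le_re_damping hδ hδε hw).trans (Complex.re_le_norm _)
  exact inv_le_of_inv_le₀ (by norm_num) (by linarith)

/-- The Cauchy kernel alone is not integrable on the line, which would block Fubini. Damped, it is a
bounded holomorphic factor times the Poisson kernel, so integrability and the representation formula
both follow from the Poisson case. -/
theorem dampedCauchy_eq {δ : ℝ} {c : ℂ} (hc : 0 < c.im) (ξ : ℝ) :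
    dampedCauchy δ c ξ = (1 - Complex.I * δ * c) * (2 * Real.pi * Complex.I)⁻¹ *
      (((ξ : ℂ) - conj c) * (1 - Complex.I * δ * ξ)⁻¹) *
      (((ξ : ℂ) - c) * ((ξ : ℂ) - conj c))⁻¹ := by
  have h : (ξ : ℂ) - conj c ≠ 0 := by
    intro h
    have := congrArg Complex.im h
    simp at this
    linarith
  rw [dampedCauchy]
  simp only [mul_inv]
  field_simp

theorem integrable_dampedCauchy {δ : ℝ} (hδ : 0 < δ) {c : ℂ} (hc : 0 < c.im) :
    Integrable (dampedCauchy δ c) := by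
  have hδε : δ * (1 / (2 * δ)) ≤ 1 / 2 := by field_simp; rfl
  have h1 : ∀ ξ : ℝ, -(1 / (2 * δ)) < (ξ : ℂ).im := fun ξ => by simp; positivity
  obtain ⟨C, hC⟩ := exists_norm_damped_le hδ hδε c
  have hcont : Continuous fun ξ : ℝ => ((ξ : ℂ) - conj c) * (1 - Complex.I * δ * ξ)⁻¹ :=
    Continuous.mul (by fun_prop)
      (Continuous.inv₀ (by fun_prop) fun ξ => damping_ne_zero hδ hδε (h1 ξ))
  have := ((integrable_inv_mul_sub_conj hc).bdd_mul hcont.aestronglyMeasurable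
    (Eventually.of_forall fun ξ => hC _ (h1 ξ))).const_mul
      ((1 - Complex.I * δ * c) * (2 * Real.pi * Complex.I)⁻¹)
  refine this.congr (Eventually.of_forall fun ξ => ?_)
  simp only [dampedCauchy_eq hc]
  ring

theorem integral_mul_dampedCauchy {ε δ : ℝ} (hε : 0 < ε) (hδ : 0 < δ) (hδε : δ * ε ≤ 1 / 2)
    {c : ℂ} (hc : 0 < c.im) {g : ℂ → ℂ} (hg : DifferentiableOn ℂ g {w | -ε < w.im})
    (hb : ∃ C, ∀ w, ‖g w‖ ≤ C) : ∫ ξ : ℝ, g ξ * dampedCauchy δ c ξ = g c := by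
  obtain ⟨A, hA⟩ := hb
  obtain ⟨C, hC⟩ := exists_norm_damped_le hδ hδε c
  have hA0 : 0 ≤ A := (norm_nonneg _).trans (hA 0)
  have hcε : -ε < c.im := by linarith
  have hp := integral_poisson hε hc
    (g := fun w => g w * ((w - conj c) * (1 - Complex.I * δ * w)⁻¹)) (C := A * C)
    (hg.mul (DifferentiableOn.mul (by fun_prop)
      (DifferentiableOn.inv (by fun_prop) fun w hw => damping_ne_zero hδ hδε hw)))
    (fun w hw => by
      rw [norm_mul]
      exact mul_le_mul (hA w) (hC w hw) (norm_nonneg _) hA0)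
  have heq : ∀ ξ : ℝ, g ξ * dampedCauchy δ c ξ = (1 - Complex.I * δ * c) *
      (2 * Real.pi * Complex.I)⁻¹ * (g ξ * (((ξ : ℂ) - conj c) * (1 - Complex.I * δ * ξ)⁻¹) *
      (((ξ : ℂ) - c) * ((ξ : ℂ) - conj c))⁻¹) := fun ξ => by
    rw [dampedCauchy_eq hc]; ring
  simp_rw [heq]
  rw [integral_const_mul, hp]
  have h0 := damping_ne_zero hδ hδε hcε
  have h1 : c - conj c = 2 * c.im * Complex.I := by
    apply Complex.ext <;> simp; ring
  have h2 : (c.im : ℂ) ≠ 0 := by exact_mod_cast hc.ne'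
  have h3 : (Real.pi : ℂ) ≠ 0 := by exact_mod_cast Real.pi_ne_zero
  rw [h1]
  field_simp

end HardyTube

/-! ### The Cauchy–Szegő kernel and its reproducing property. -/

namespace HardyTube

open scoped ENNReal ComplexConjugate

variable {n : ℕ} {F : (Fin n → ℂ) → ℂ} {z : Fin n → ℂ}

theorem sub_conj_ne_zero {z w : Fin n → ℂ} (hz : z ∈ tube n) (hw : ∀ k, 0 ≤ (w k).im) (k : Fin n) :
    w k - conj (z k) ≠ 0 := by
  intro h
  have h1 := congrArg Complex.im h
  have h2 : 0 < (z k).im := hz k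
  have h3 := hw k
  simp at h1
  linarith

theorem im_nonneg_of_mem_tube {w : Fin n → ℂ} (hw : w ∈ tube n) (k : Fin n) : 0 ≤ (w k).im :=
  le_of_lt (hw k)

/-- Raising the height of a point moves it away from `conj z`, which lies below the real axis. The
square integrable trace thus dominates all slices. -/
theorem norm_szego_pt_le (hz : z ∈ tube n) {y : Fin n → ℝ} (hy : y ∈ octant n) (x : Fin n → ℝ) :
    ‖szego z (pt x y)‖ ≤ ‖szego z (pt x 0)‖ := by
  simp only [szego, norm_prod, norm_div, norm_mul]
  refine Finset.prod_le_prod (fun k _ => by positivity) fun k _ => ?_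
  have h0 : 0 < ‖pt x 0 k - conj (z k)‖ :=
    norm_pos_iff.2 (sub_conj_ne_zero hz (fun k => by simp [pt]) k)
  have hle : ‖pt x 0 k - conj (z k)‖ ≤ ‖pt x y k - conj (z k)‖ := by
    have h2 : 0 < (z k).im := hz k
    have h3 : 0 < y k := hy k
    rw [Complex.norm_def, Complex.norm_def]
    apply Real.sqrt_le_sqrt
    simp only [Complex.normSq_apply, pt]
    simp
    nlinarith
  exact div_le_div_of_nonneg_left (by positivity)
    (mul_pos (by simp) h0) (mul_le_mul_of_nonneg_left hle (by positivity))

theorem continuous_szego_trace (hz : z ∈ tube n) : Continuous fun ξ => szego z (pt ξ 0) := by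
  unfold szego
  refine continuous_finsetProd _ fun k _ => ?_
  refine Continuous.div continuous_const ?_ fun ξ => ?_
  · unfold pt; fun_prop
  · have h1 := sub_conj_ne_zero (w := pt ξ 0) hz (fun k => by simp [pt]) k
    simp [Real.pi_ne_zero, h1]

theorem memLp_szego_trace (hz : z ∈ tube n) : MemLp (fun ξ => szego z (pt ξ 0)) 2 volume := by
  rw [memLp_two_iff_integrable_sq_norm (continuous_szego_trace hz).aestronglyMeasurable]
  have h : Integrable fun ξ : Fin n → ℝ =>
      ∏ k, (((2 * Real.pi) ^ 2)⁻¹ * ((ξ k - (z k).re) ^ 2 + (z k).im ^ 2)⁻¹) :=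
    Integrable.fintype_prod (f := fun k (ξ : ℝ) =>
      ((2 * Real.pi) ^ 2)⁻¹ * ((ξ - (z k).re) ^ 2 + (z k).im ^ 2)⁻¹)
      fun k => (integrable_inv_sq_add_sq _ (hz k)).const_mul _
  refine h.congr (Eventually.of_forall fun ξ => ?_)
  simp only [szego, norm_prod, ← Finset.prod_pow]
  refine Finset.prod_congr rfl fun k _ => ?_
  have : ‖pt ξ 0 k - conj (z k)‖ ^ 2 = (ξ k - (z k).re) ^ 2 + (z k).im ^ 2 := by
    rw [← Complex.normSq_eq_norm_sq, Complex.normSq_apply]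
    simp [pt]
    ring
  rw [norm_div, norm_mul _ (pt ξ 0 k - conj (z k)), div_pow, mul_pow _ ‖pt ξ 0 k - conj (z k)‖, this]
  simp [mul_comm, mul_pow]

theorem memHardy_szego (hz : z ∈ tube n) : MemHardy (szego z) := by
  constructor
  · unfold szego
    have h : ∀ k, DifferentiableOn ℂ (fun w : Fin n → ℂ =>
        (-1) / (2 * (Real.pi : ℂ) * Complex.I * (w k - conj (z k)))) (tube n) := by
      intro k
      simp_rw [div_eq_mul_inv]
      refine (DifferentiableOn.inv (by fun_prop) fun w hw => ?_).const_mul (-1)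
      have h1 := sub_conj_ne_zero hz (im_nonneg_of_mem_tube hw) k
      simp [Real.pi_ne_zero, h1]
    exact fun w hw => (HasFDerivWithinAt.finsetProd fun k _ =>
      (h k w hw).hasFDerivWithinAt).differentiableWithinAt
  · have hlt : (ENNReal.ofReal (‖(memLp_szego_trace hz).toLp‖ ^ 2)) < ⊤ := ENNReal.ofReal_lt_top
    refine lt_of_le_of_lt (iSup₂_le fun y hy => ?_) hlt
    rw [← lintegral_enorm_sq_toLp]
    refine lintegral_mono fun x => ?_
    gcongr 1
    exact enorm_le_iff_norm_le.2 (norm_szego_pt_le hz hy x)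

/-- The boundary value is only an `L²` limit, but a subsequence converges almost everywhere, and the
kernel is continuous up to height `0`; the two limits agree. -/
theorem MemHardy.bdry_szego (hz : z ∈ tube n) :
    (memHardy_szego hz).bdry = (memLp_szego_trace hz).toLp := by
  have hbv := (memHardy_szego hz).isBoundaryValue_boundaryValue
  have hm : TendstoInMeasure volume
      (fun (m : ℕ) ξ => szego z (pt ξ fun _ => 1 / ((m : ℝ) + 1))) atTop
      (boundaryValue (szego z)) :=
    tendstoInMeasure_of_tendsto_eLpNorm (p := 2) (by simp)
      (fun m => ((memHardy_szego hz).memLp_slice fun _ => by positivity).1) hbv.1.1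
      (hbv.2.comp tendsto_one_div_octant)
  obtain ⟨ns, hns, hae⟩ := hm.exists_seq_tendsto_ae
  rw [MemHardy.bdry, MemLp.toLp_eq_toLp_iff]
  filter_upwards [hae] with ξ hξ
  refine tendsto_nhds_unique hξ ?_
  have hcont : ContinuousAt (fun η : Fin n → ℝ => szego z (pt ξ η)) 0 := by
    unfold szego
    refine tendsto_finsetProd _ fun k _ => ?_
    refine ContinuousAt.div continuousAt_const ?_ ?_
    · exact Continuous.continuousAt (by unfold pt; fun_prop)
    · have h1 := sub_conj_ne_zero (w := pt ξ 0) hz (fun k => by simp [pt]) k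
      simp [Real.pi_ne_zero, h1]
  exact hcont.tendsto.comp
    ((tendsto_one_div_octant.comp hns.tendsto_atTop).mono_right nhdsWithin_le_nhds)

theorem conj_szego_trace (z : Fin n → ℂ) (ξ : Fin n → ℝ) :
    conj (szego z (pt ξ 0)) = ∏ k, (2 * Real.pi * Complex.I * ((ξ k : ℂ) - z k))⁻¹ := by
  simp only [szego, map_prod]
  refine Finset.prod_congr rfl fun k _ => ?_
  simp only [pt, map_div₀, map_mul, map_sub, map_neg, map_one, Complex.conj_conj, Complex.conj_I,
    Complex.conj_ofReal, map_ofNat, Pi.zero_apply, Complex.ofReal_zero, zero_mul, add_zero]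
  rw [neg_div, ← div_neg, one_div]
  congr 1
  ring

theorem tendsto_dampedCauchy (c : ℂ) (ξ : ℝ) :
    Tendsto (fun δ => dampedCauchy δ c ξ) (𝓝[>] 0) (𝓝 (2 * Real.pi * Complex.I * (ξ - c))⁻¹) := by
  have h : Tendsto (fun δ : ℝ => (1 - Complex.I * δ * c) *
      ((2 * Real.pi * Complex.I * (ξ - c))⁻¹ * (1 - Complex.I * δ * ξ)⁻¹)) (𝓝 0)
      (𝓝 ((1 - Complex.I * (0 : ℝ) * c) *
      ((2 * Real.pi * Complex.I * (ξ - c))⁻¹ * (1 - Complex.I * (0 : ℝ) * ξ)⁻¹))) := by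
    have hc : ContinuousAt (fun δ : ℝ => (1 - Complex.I * δ * c) *
      ((2 * Real.pi * Complex.I * (ξ - c))⁻¹ * (1 - Complex.I * δ * ξ)⁻¹)) 0 := by
      refine ContinuousAt.mul (by fun_prop) (ContinuousAt.mul continuousAt_const
        (ContinuousAt.inv₀ (by fun_prop) (by simp)))
    exact hc.tendsto
  refine (h.mono_left nhdsWithin_le_nhds).congr (fun δ => ?_) |>.trans ?_
  · rw [dampedCauchy]
    simp only [mul_inv]
  · simp

theorem norm_dampedCauchy_le {δ : ℝ} (h0 : 0 < δ) (h1 : δ ≤ 1) (c : ℂ) (ξ : ℝ) :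
    ‖dampedCauchy δ c ξ‖ ≤ (1 + ‖c‖) * ‖(2 * Real.pi * Complex.I * ((ξ : ℂ) - c))⁻¹‖ := by
  rw [dampedCauchy, mul_inv _ (1 - Complex.I * δ * ξ), norm_mul, norm_mul]
  have h2 : ‖1 - Complex.I * δ * c‖ ≤ 1 + ‖c‖ := by
    refine (norm_sub_le _ _).trans ?_
    rw [norm_one, norm_mul, norm_mul, Complex.norm_I, one_mul, Complex.norm_real,
      Real.norm_of_nonneg h0.le]
    have := mul_le_of_le_one_left (norm_nonneg c) h1
    linarith
  have h3 : ‖(1 - Complex.I * δ * (ξ : ℂ))⁻¹‖ ≤ 1 := by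
    rw [norm_inv]
    refine inv_le_one_of_one_le₀ ?_
    refine le_trans ?_ (Complex.re_le_norm _)
    simp
  have h4 : ‖(2 * Real.pi * Complex.I * ((ξ : ℂ) - c))⁻¹‖ * ‖(1 - Complex.I * δ * (ξ : ℂ))⁻¹‖ ≤
      ‖(2 * Real.pi * Complex.I * ((ξ : ℂ) - c))⁻¹‖ * 1 := by gcongr
  rw [mul_one] at h4
  gcongr

namespace MemHardy

/-- The Cauchy formula on the slice of height `(ε, …, ε)`. -/
theorem integral_slice_mul_conj_szego (hF : MemHardy F) (hz : z ∈ tube n) {ε : ℝ} (hε : 0 < ε) :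
    ∫ ξ, F (pt ξ fun _ => ε) * conj (szego z (pt ξ 0)) = F (z + pt 0 fun _ => ε) := by
  classical
  have hεo : (fun _ => ε : Fin n → ℝ) ∈ octant n := fun _ => hε
  -- The half plane reaches below the real axis, as the Poisson formula requires. After the shift by
  -- `iε` every point has height above `ε / 2`, so a closed polydisc of radius `ε / 4` fits in the
  -- tube and the shifted function is bounded there.
  set U : Set ℂ := {w | -(ε / 2) < w.im} with hU
  have hUo : IsOpen U := isOpen_lt continuous_const Complex.continuous_im
  set P : Set (Fin n → ℂ) := Set.univ.pi fun _ => U with hP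
  have hPo : IsOpen P := isOpen_set_pi Set.finite_univ fun _ _ => hUo
  have hball : ∀ w ∈ P, Metric.closedBall (w + pt 0 fun _ => ε) (ε / 4) ⊆ tube n := by
    intro w hw v hv j
    rw [Metric.mem_closedBall, dist_eq_norm, pi_norm_le_iff_of_nonneg (by positivity)] at hv
    have h1 := (Complex.abs_im_le_norm _).trans (hv j)
    have h2 : -(ε / 2) < (w j).im := hw j trivial
    simp [pt] at h1
    have := (abs_le.1 h1).1
    simp only
    linarith
  have hmaps : Set.MapsTo (fun w => w + pt 0 fun _ => ε) P (tube n) := fun w hw =>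
    hball w hw (Metric.mem_closedBall_self (by positivity))
  have hd : DifferentiableOn ℂ (fun w => F (w + pt 0 fun _ => ε)) P :=
    hF.1.comp (f := fun w => w + pt 0 fun _ => ε) (by fun_prop) hmaps
  set G : (Fin n → ℂ) → ℂ := P.indicator fun w => F (w + pt 0 fun _ => ε) with hG
  have hGm : Measurable G := by
    rw [hG, ← Set.piecewise_eq_indicator]
    exact hd.continuousOn.measurable_piecewise continuousOn_const hPo.measurableSet
  have hGd : DifferentiableOn ℂ G P := hd.congr fun w hw => Set.indicator_of_mem hw _
  obtain ⟨C, hC⟩ := exists_norm_sq_le_normSq n (r := ε / 4) (by positivity)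
  have hGb : ∃ C, ∀ w, ‖G w‖ ≤ C := by
    refine ⟨Real.sqrt (C * (normSq F).toReal), fun w => ?_⟩
    by_cases hw : w ∈ P
    · rw [hG, Set.indicator_of_mem hw]
      exact Real.le_sqrt_of_sq_le (hC F hF _ (hball w hw))
    · rw [hG, Set.indicator_of_notMem hw, norm_zero]
      positivity
  have hzP : z ∈ P := fun k _ => by
    have : 0 < (z k).im := hz k
    simp only [hU, Set.mem_ofPred_eq]
    linarith
  have hreal : ∀ ξ : Fin n → ℝ, (fun k => (ξ k : ℂ)) ∈ P := fun ξ k _ => by simp [hU, hε]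
  have hGreal : ∀ ξ : Fin n → ℝ, G (fun k => (ξ k : ℂ)) = F (pt ξ fun _ => ε) := fun ξ => by
    rw [hG, Set.indicator_of_mem (hreal ξ)]
    congr 1; ext k; simp [pt]
  have hdamp : ∀ δ : ℝ, 0 < δ → δ * (ε / 2) ≤ 1 / 2 →
      ∫ ξ : Fin n → ℝ, F (pt ξ fun _ => ε) * ∏ k, dampedCauchy δ (z k) (ξ k) =
        F (z + pt 0 fun _ => ε) := by
    intro δ hδ hδε
    have := integral_pi_mul_prod_eq (μ := (volume : Measure ℝ)) (U := U)
      (e := fun ξ : ℝ => (ξ : ℂ)) Complex.measurable_ofReal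
      (Eventually.of_forall fun ξ => by simp [hU, hε]) n (fun k => dampedCauchy δ (z k)) z
      (fun k => hzP k trivial) (fun k => integrable_dampedCauchy hδ (hz k))
      (fun k g _ hg hb => integral_mul_dampedCauchy (by positivity) hδ hδε (hz k) hg hb)
      G hGm hGd hGb
    simp only [hGreal] at this
    rw [volume_pi, this, hG, Set.indicator_of_mem hzP]
  have hcont : Continuous fun ξ => F (pt ξ fun _ => ε) := hF.continuous_slice hεo
  -- The damping is removed by dominated convergence. The majorant is a constant times the product
  -- of two `L²` functions, the slice of `F` and the kernel trace.
  have hlim : Tendsto (fun δ : ℝ => ∫ ξ : Fin n → ℝ, F (pt ξ fun _ => ε) *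
      ∏ k, dampedCauchy δ (z k) (ξ k)) (𝓝[>] 0)
      (𝓝 (∫ ξ, F (pt ξ fun _ => ε) * conj (szego z (pt ξ 0)))) := by
    have hprod : Integrable fun ξ => ‖F (pt ξ fun _ => ε)‖ * ‖szego z (pt ξ 0)‖ :=
      (hF.memLp_slice hεo).norm.integrable_mul (memLp_szego_trace hz).norm
    refine tendsto_integral_filter_of_dominated_convergence
      (fun ξ => (∏ k, (1 + ‖z k‖)) * (‖F (pt ξ fun _ => ε)‖ * ‖szego z (pt ξ 0)‖)) ?_ ?_
      (hprod.const_mul _) ?_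
    · filter_upwards [self_mem_nhdsWithin] with δ hδ
      refine hcont.aestronglyMeasurable.mul ?_
      exact (Integrable.fintype_prod fun k => integrable_dampedCauchy hδ (hz k)).1
    · filter_upwards [Ioc_mem_nhdsGT (zero_lt_one' ℝ)] with δ hδ
      refine Eventually.of_forall fun ξ => ?_
      rw [norm_mul, norm_prod, mul_left_comm]
      refine mul_le_mul_of_nonneg_left ?_ (norm_nonneg _)
      rw [← Complex.norm_conj (szego z (pt ξ 0)), conj_szego_trace, norm_prod,
        ← Finset.prod_mul_distrib]
      exact Finset.prod_le_prod (fun k _ => norm_nonneg _)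
        fun k _ => norm_dampedCauchy_le hδ.1 hδ.2 _ _
    · refine Eventually.of_forall fun ξ => ?_
      rw [conj_szego_trace]
      exact (tendsto_finsetProd _ fun k _ => tendsto_dampedCauchy _ _).const_mul _
  refine tendsto_nhds_unique hlim (tendsto_const_nhds.congr' ?_)
  filter_upwards [Ioc_mem_nhdsGT (by positivity : 0 < 1 / ε)] with δ hδ
  refine (hdamp δ hδ.1 ?_).symm
  have := mul_le_mul_of_nonneg_right hδ.2 hε.le
  rw [div_mul_cancel₀ _ hε.ne'] at this
  linarith

/-- The reproducing property of the Cauchy-Szegő kernel. -/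
theorem inner_bdry_szego (hF : MemHardy F) (hz : z ∈ tube n) :
    inner ℂ (memHardy_szego hz).bdry hF.bdry = F z := by
  rw [bdry_szego hz]
  have hη : Tendsto (fun ε : ℝ => fun _ : Fin n => ε) (𝓝[>] 0) (𝓝[octant n] 0) := by
    refine tendsto_nhdsWithin_iff.2 ⟨?_, ?_⟩
    · refine tendsto_pi_nhds.2 fun j => ?_
      exact tendsto_id.mono_left nhdsWithin_le_nhds
    · filter_upwards [self_mem_nhdsWithin] with ε hε j using hε
  have h1 : Tendsto (fun ε : ℝ => inner ℂ (memLp_szego_trace hz).toLp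
      (sliceLp F fun _ => ε)) (𝓝[>] 0) (𝓝 (inner ℂ (memLp_szego_trace hz).toLp hF.bdry)) :=
    tendsto_const_nhds.inner (hF.tendsto_sliceLp.comp hη)
  refine tendsto_nhds_unique h1 ?_
  have hF0 : ContinuousAt F z := hF.1.continuousOn.continuousAt (isOpen_tube.mem_nhds hz)
  have hsh : Tendsto (fun ε : ℝ => z + pt 0 fun _ : Fin n => ε) (𝓝[>] 0) (𝓝 z) := by
    have : Continuous fun ε : ℝ => z + pt 0 fun _ : Fin n => ε := by unfold pt; fun_prop
    have h2 := this.tendsto 0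
    have h3 : (z + pt 0 fun _ : Fin n => (0 : ℝ)) = z := by ext j; simp [pt]
    rw [h3] at h2
    exact h2.mono_left nhdsWithin_le_nhds
  refine (hF0.tendsto.comp hsh).congr' ?_
  filter_upwards [self_mem_nhdsWithin] with ε hε
  have hεo : (fun _ => ε : Fin n → ℝ) ∈ octant n := fun _ => hε
  rw [Function.comp_apply, hF.sliceLp_eq hεo, inner_toLp, hF.integral_slice_mul_conj_szego hz hε]

end MemHardy
end HardyTube

/-! ### Derivatives of the kernel and admissible rules. -/

namespace HardyTube

open scoped ENNReal ComplexConjugate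

variable {n : ℕ} {F G : (Fin n → ℂ) → ℂ}

namespace MemHardy

theorem congr (hF : MemHardy F) (h : Set.EqOn G F (tube n)) : MemHardy G := by
  refine ⟨hF.1.congr h, ?_⟩
  have : normSq G = normSq F := by
    unfold normSq
    refine iSup_congr fun y => iSup_congr fun hy => lintegral_congr fun x => ?_
    rw [h (pt_mem_tube.2 hy)]
  rw [this]
  exact hF.2

theorem mul_bdd (hF : MemHardy F) (hG : DifferentiableOn ℂ G (tube n)) {C : ℝ}
    (hC : ∀ w ∈ tube n, ‖G w‖ ≤ C) : MemHardy (F * G) := by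
  refine ⟨hF.1.mul hG, ?_⟩
  have hlt : ENNReal.ofReal C ^ 2 * normSq F < ⊤ :=
    ENNReal.mul_lt_top (ENNReal.pow_lt_top ENNReal.ofReal_lt_top) hF.2
  refine lt_of_le_of_lt (iSup₂_le fun y hy => ?_) hlt
  calc ∫⁻ x : Fin n → ℝ, ‖(F * G) (pt x y)‖ₑ ^ 2
      ≤ ∫⁻ x : Fin n → ℝ, ENNReal.ofReal C ^ 2 * ‖F (pt x y)‖ₑ ^ 2 := by
        refine lintegral_mono fun x => ?_
        rw [← mul_pow, Pi.mul_apply, enorm_mul, mul_comm]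
        gcongr
        rw [← ofReal_norm]
        exact ENNReal.ofReal_le_ofReal (hC _ (pt_mem_tube.2 hy))
    _ = ENNReal.ofReal C ^ 2 * ∫⁻ x : Fin n → ℝ, ‖F (pt x y)‖ₑ ^ 2 :=
        lintegral_const_mul' _ _ (ENNReal.pow_ne_top ENNReal.ofReal_ne_top)
    _ ≤ _ := by gcongr; exact lintegral_slice_le hy

end MemHardy

/-- The vector with entries `1 / (w_k - conj z_k)`. -/
noncomputable def invDiff (z w : Fin n → ℂ) (k : Fin n) : ℂ := (w k - conj (z k))⁻¹

theorem hasLineDerivAt_invDiff {z w : Fin n → ℂ} (hz : z ∈ tube n) (hw : w ∈ tube n)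
    (l : Fin n → ℂ) (k : Fin n) :
    HasLineDerivAt ℝ (fun ζ => invDiff ζ w k) (conj (l k) * invDiff z w k ^ 2) z l := by
  have hne := sub_conj_ne_zero hz (im_nonneg_of_mem_tube hw) k
  have h1 : HasDerivAt (fun t : ℝ => w k - conj (z k) - t * conj (l k)) (-conj (l k)) 0 := by
    simpa using ((Complex.ofRealCLM.hasDerivAt (x := (0 : ℝ))).mul_const (conj (l k))).const_sub
      (w k - conj (z k))
  have h2 := h1.inv (by simpa using hne)
  have heq : (fun t : ℝ => invDiff (z + t • l) w k) =
      (fun t : ℝ => w k - conj (z k) - t * conj (l k))⁻¹ := by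
    ext t
    simp only [invDiff, Pi.inv_apply, Pi.add_apply, Pi.smul_apply, Complex.real_smul, map_add,
      map_mul, Complex.conj_ofReal]
    ring
  rw [HasLineDerivAt, heq]
  refine h2.congr_deriv ?_
  simp only [invDiff, Complex.ofReal_zero, zero_mul, sub_zero, neg_neg]
  rw [inv_pow, div_eq_mul_inv]

theorem szego_eq_prod_invDiff (z w : Fin n → ℂ) :
    szego z w = ∏ k, ((-1) / (2 * (Real.pi : ℂ) * Complex.I) * invDiff z w k) := by
  simp only [szego, invDiff]
  refine Finset.prod_congr rfl fun k _ => ?_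
  rw [div_mul_eq_div_div, div_eq_mul_inv]

theorem hasLineDerivAt_szego {z w : Fin n → ℂ} (hz : z ∈ tube n) (hw : w ∈ tube n)
    (l : Fin n → ℂ) :
    HasLineDerivAt ℝ (fun ζ => szego ζ w) (szego z w * ∑ k, conj (l k) * invDiff z w k) z l := by
  have h : ∀ k ∈ Finset.univ, HasDerivAt
      (fun t : ℝ => (-1) / (2 * (Real.pi : ℂ) * Complex.I) * invDiff (z + t • l) w k)
      ((-1) / (2 * (Real.pi : ℂ) * Complex.I) * (conj (l k) * invDiff z w k ^ 2)) 0 := fun k _ =>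
    HasDerivAt.const_mul _ (hasLineDerivAt_invDiff hz hw l k)
  have h2 := HasDerivAt.fun_finsetProd h
  simp only [← szego_eq_prod_invDiff] at h2
  rw [HasLineDerivAt]
  refine h2.congr_deriv ?_
  rw [Finset.mul_sum]
  refine Finset.sum_congr rfl fun k hk => ?_
  simp only [zero_smul, add_zero, smul_eq_mul]
  rw [szego_eq_prod_invDiff, ← Finset.mul_prod_erase _ _ hk]
  ring

theorem exists_hasLineDerivAt_eval_invDiff (l : Fin n → ℂ) (p : MvPolynomial (Fin n) ℂ) :
    ∃ q : MvPolynomial (Fin n) ℂ, ∀ z ∈ tube n, ∀ w ∈ tube n,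
      HasLineDerivAt ℝ (fun ζ => MvPolynomial.eval (invDiff ζ w) p)
        (MvPolynomial.eval (invDiff z w) q) z l := by
  induction p using MvPolynomial.induction_on with
  | C a =>
    refine ⟨0, fun z _ w _ => ?_⟩
    simp only [MvPolynomial.eval_C, map_zero]
    exact hasDerivAt_const (0 : ℝ) a
  | add p q hp hq =>
    obtain ⟨p', hp⟩ := hp
    obtain ⟨q', hq⟩ := hq
    refine ⟨p' + q', fun z hz w hw => ?_⟩
    simp only [map_add]
    exact HasDerivAt.add (hp z hz w hw) (hq z hz w hw)
  | mul_X p i hp =>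
    obtain ⟨p', hp⟩ := hp
    refine ⟨p' * MvPolynomial.X i + p * (MvPolynomial.C (conj (l i)) * MvPolynomial.X i ^ 2),
      fun z hz w hw => ?_⟩
    have := HasDerivAt.mul (hp z hz w hw) (hasLineDerivAt_invDiff hz hw l i)
    simp only [zero_smul, add_zero] at this
    simp only [map_add, map_mul, map_pow, MvPolynomial.eval_X, MvPolynomial.eval_C]
    exact this

/-- Differentiating the kernel or `1 / (w_k - conj z_k)` in `z` only produces further factors of the
latter kind. The polynomial is chosen independently of `z` and `w`, so that the formula can be
differentiated again in the induction. -/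
theorem exists_iterDirDeriv_eq (L : List (Fin n → ℂ)) :
    ∃ p : MvPolynomial (Fin n) ℂ, ∀ z ∈ tube n, ∀ w ∈ tube n,
      iterDirDeriv L z w = szego z w * MvPolynomial.eval (invDiff z w) p := by
  induction L with
  | nil => exact ⟨1, fun z _ w _ => by simp [iterDirDeriv]⟩
  | cons l L ih =>
    obtain ⟨p, hp⟩ := ih
    obtain ⟨q, hq⟩ := exists_hasLineDerivAt_eval_invDiff l p
    refine ⟨(∑ k, MvPolynomial.C (conj (l k)) * MvPolynomial.X k) * p + q,
      fun z hz w hw => ?_⟩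
    have h1 : HasLineDerivAt ℝ (fun ζ => szego ζ w * MvPolynomial.eval (invDiff ζ w) p)
        (szego z w * (∑ k, conj (l k) * invDiff z w k) * MvPolynomial.eval (invDiff z w) p +
          szego z w * MvPolynomial.eval (invDiff z w) q) z l := by
      have := HasDerivAt.mul (hasLineDerivAt_szego hz hw l) (hq z hz w hw)
      simp only [zero_smul, add_zero] at this
      exact this
    have h2 : (fun ζ => iterDirDeriv L ζ w) =ᶠ[𝓝 z]
        fun ζ => szego ζ w * MvPolynomial.eval (invDiff ζ w) p := by
      filter_upwards [isOpen_tube.mem_nhds hz] with ζ hζ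
      exact hp ζ hζ w hw
    rw [iterDirDeriv, (h1.congr_of_eventuallyEq h2).lineDeriv]
    simp only [map_add, map_mul, map_sum, MvPolynomial.eval_X, MvPolynomial.eval_C]
    ring

theorem memHardy_iterDirDeriv {z : Fin n → ℂ} (hz : z ∈ tube n) (L : List (Fin n → ℂ)) :
    MemHardy (iterDirDeriv L z) := by
  obtain ⟨p, hp⟩ := exists_iterDirDeriv_eq L
  have hd : DifferentiableOn ℂ (fun w => MvPolynomial.eval (invDiff z w) p) (tube n) := by
    have hX : ∀ k, DifferentiableOn ℂ (fun w => invDiff z w k) (tube n) := fun k =>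
      DifferentiableOn.inv (by fun_prop)
        fun w hw => sub_conj_ne_zero hz (im_nonneg_of_mem_tube hw) k
    clear hp
    induction p using MvPolynomial.induction_on with
    | C a => simp only [MvPolynomial.eval_C]; exact differentiableOn_const a
    | add p q hp hq => simp only [map_add]; exact hp.add hq
    | mul_X p i hp => simp only [map_mul, MvPolynomial.eval_X]; exact hp.mul (hX i)
  -- For `w` in the tube, `|w_k - conj z_k| ≥ Im z_k`. The vector `invDiff z w` therefore stays in
  -- this ball, where the polynomial is bounded.
  obtain ⟨C, hC⟩ := (isCompact_closedBall (0 : Fin n → ℂ)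
    (∑ k, ((z k).im)⁻¹)).exists_bound_of_continuousOn (MvPolynomial.continuous_eval p).continuousOn
  have hzi : ∀ k, 0 < (z k).im := hz
  refine ((memHardy_szego hz).mul_bdd hd (C := C) fun w hw => hC _ ?_).congr
    fun w hw => hp z hz w hw
  rw [mem_closedBall_zero_iff, pi_norm_le_iff_of_nonneg
    (Finset.sum_nonneg fun k _ => (inv_pos.2 (hzi k)).le)]
  intro k
  have hwk : 0 < (w k).im := hw k
  refine le_trans ?_ (Finset.single_le_sum (f := fun k => ((z k).im)⁻¹)
    (fun k _ => (inv_pos.2 (hzi k)).le) (Finset.mem_univ k))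
  rw [invDiff, norm_inv]
  refine inv_anti₀ (hzi k) ?_
  refine le_trans ?_ (Complex.abs_im_le_norm _)
  refine le_trans ?_ (le_abs_self _)
  simp only [Complex.sub_im, Complex.conj_im]
  linarith

theorem span_dictionary_le {z : Fin n → ℂ} (hz : z ∈ tube n) (h : ℕ) :
    Submodule.span ℂ (dictionary h z) ≤ hardySpace n := by
  rw [Submodule.span_le]
  rintro g ⟨L, -, -, rfl⟩
  exact memHardy_iterDirDeriv hz L

theorem dictionary_zero (z : Fin n → ℂ) : dictionary 0 z = {szego z} := by
  ext g
  constructor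
  · rintro ⟨L, hL, -, rfl⟩
    rw [List.length_eq_zero_iff] at hL
    subst hL
    rfl
  · rintro rfl
    exact ⟨[], rfl, by simp, rfl⟩

namespace Rule.IsAdmissible

variable {Φ : Rule n}

theorem system_mem (hΦ : Φ.IsAdmissible) {m : ℕ} {p : Fin m → (Fin n → ℂ)}
    (hp : ∀ i, p i ∈ tube n) (k : Fin m) : MemHardy (Φ.system p k) := by
  obtain ⟨h, -, -, hmem⟩ := (hΦ m p hp).2 k
  exact span_dictionary_le (hp k) h hmem

/-- At a point which occurs for the first time, the attached function is a nonzero multiple of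
the Cauchy-Szegő kernel. -/
theorem exists_system_eq_smul_szego (hΦ : Φ.IsAdmissible) {m : ℕ}
    {p : Fin m → (Fin n → ℂ)} (hp : ∀ i, p i ∈ tube n) (k : Fin m)
    (hk : ∀ j < k, p j ≠ p k) : ∃ c : ℂ, c ≠ 0 ∧ Φ.system p k = c • szego (p k) := by
  obtain ⟨hli, hmem⟩ := hΦ m p hp
  obtain ⟨h, h1, -, h2⟩ := hmem k
  have hmult : mult p k = 1 := by
    rw [mult, Set.ncard_eq_one]
    refine ⟨k, Set.eq_singleton_iff_unique_mem.2 ⟨⟨le_rfl, rfl⟩, fun j hj => ?_⟩⟩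
    by_contra hne
    exact hk j (lt_of_le_of_ne hj.1 hne) hj.2
  -- With multiplicity one the binomial coefficient must vanish, so `h + n - 1 < n`, which leaves
  -- only order zero.
  rw [hmult, Nat.lt_one_iff, Nat.choose_eq_zero_iff] at h1
  have h0 : h = 0 := by omega
  subst h0
  rw [dictionary_zero, Submodule.mem_span_singleton] at h2
  obtain ⟨c, hc⟩ := h2
  refine ⟨c, ?_, hc.symm⟩
  rintro rfl
  refine hli.ne_zero k ?_
  rw [← hc, zero_smul]
  rfl

end Rule.IsAdmissible

end HardyTube

/-! ### Orthogonal projections and residuals. -/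

namespace HardyTube

open scoped ENNReal ComplexConjugate

section Hilbert

variable {E : Type*} [NormedAddCommGroup E] [InnerProductSpace ℂ E]

/-- The linear combination of the `φ k` with coefficients computed from the inverse Gram matrix
is the orthogonal projection. -/
theorem inner_sub_gram_combination_eq_zero {m : ℕ} {φ : Fin m → E} (hφ : LinearIndependent ℂ φ)
    (f : E) (i : Fin m) :
    inner ℂ (φ i) (f - ∑ k, (∑ j, inner ℂ (φ j) f * conj ((Matrix.gram ℂ φ)⁻¹ j k)) • φ k) = 0 := by
  set A := Matrix.gram ℂ φ with hA
  have hdet : IsUnit A.det := (Matrix.det_gram_ne_zero_iff_linearIndependent.2 hφ).isUnit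
  -- The inverse of a Hermitian matrix is Hermitian, so the coefficients form the vector `A⁻¹ b` and
  -- solve the normal equations.
  have hconj : ∀ j k, conj (A⁻¹ j k) = A⁻¹ k j := fun j k => by
    have := (Matrix.isHermitian_gram ℂ φ).inv.apply k j
    exact this
  set b : Fin m → ℂ := fun j => inner ℂ (φ j) f with hb
  have h1 : ∀ k, ∑ j, b j * conj (A⁻¹ j k) = (A⁻¹.mulVec b) k := fun k => by
    simp only [Matrix.mulVec, dotProduct, hconj]
    exact Finset.sum_congr rfl fun j _ => mul_comm _ _
  rw [inner_sub_right, inner_sum, sub_eq_zero]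
  have h2 : ∀ k, inner ℂ (φ i) ((∑ j, b j * conj (A⁻¹ j k)) • φ k) = A i k * (A⁻¹.mulVec b) k :=
    fun k => by rw [inner_smul_right, h1, mul_comm]; rfl
  have h3 : ∑ k, inner ℂ (φ i) ((∑ j, b j * conj (A⁻¹ j k)) • φ k) = (A.mulVec (A⁻¹.mulVec b)) i :=
    Finset.sum_congr rfl fun k _ => h2 k
  rw [h3, Matrix.mulVec_mulVec, Matrix.mul_nonsing_inv _ hdet, Matrix.one_mulVec]

theorem inner_eq_zero_of_mem_span_range {ι : Type*} {φ : ι → E} {r : E}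
    (hr : ∀ i, inner ℂ (φ i) r = 0) {v : E} (hv : v ∈ Submodule.span ℂ (Set.range φ)) :
    inner ℂ v r = 0 := by
  induction hv using Submodule.span_induction with
  | mem x hx => obtain ⟨i, rfl⟩ := hx; exact hr i
  | zero => exact inner_zero_left _
  | add x y _ _ hx hy => rw [inner_add_left, hx, hy, add_zero]
  | smul c x _ hx => rw [inner_smul_left, hx, mul_zero]

theorem norm_add_sq_of_inner_eq_zero {v r : E} (h : inner ℂ v r = 0) :
    ‖v + r‖ ^ 2 = ‖v‖ ^ 2 + ‖r‖ ^ 2 := by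
  simp only [sq]
  exact norm_add_sq_eq_norm_sq_add_norm_sq_of_inner_eq_zero v r h

/-- The multiple `t • κ` is the projection of `r` onto the line of `κ`. With `κ` a kernel, this
turns a point value of `r` into the decrease of norm that the kernel can achieve. -/
theorem exists_norm_sub_smul_sq (κ r : E) :
    ∃ t : ℂ, ‖inner ℂ κ r‖ ^ 2 = ‖κ‖ ^ 2 * (‖r‖ ^ 2 - ‖r - t • κ‖ ^ 2) := by
  rcases eq_or_ne κ 0 with rfl | hκ
  · exact ⟨0, by simp⟩
  have hκ0 : ‖κ‖ ≠ 0 := norm_ne_zero_iff.2 hκ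
  have hκc : (‖κ‖ : ℂ) ≠ 0 := by exact_mod_cast hκ0
  have hself : inner ℂ κ κ = (‖κ‖ : ℂ) ^ 2 := by
    rw [inner_self_eq_norm_sq_to_K (𝕜 := ℂ)]; simp
  refine ⟨inner ℂ κ r / (‖κ‖ : ℂ) ^ 2, ?_⟩
  set t := inner ℂ κ r / (‖κ‖ : ℂ) ^ 2 with ht
  have h0 : inner ℂ (t • κ) (r - t • κ) = 0 := by
    rw [inner_smul_left, inner_sub_right, inner_smul_right, hself, ht]
    field_simp
    simp
  have h1 := norm_add_sq_of_inner_eq_zero h0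
  rw [add_sub_cancel] at h1
  rw [h1, add_sub_cancel_right, norm_smul, ht, norm_div, norm_pow, Complex.norm_real, norm_norm]
  field_simp

end Hilbert

variable {n : ℕ}

/-- The element of `L²` which represents the evaluation at a point of the tube. -/
noncomputable def kernelLp {w : Fin n → ℂ} (hw : w ∈ tube n) :
    Lp ℂ 2 (volume : Measure (Fin n → ℝ)) :=
  bdryMap ⟨szego w, memHardy_szego hw⟩

theorem inner_kernelLp {w : Fin n → ℂ} (hw : w ∈ tube n) (F : hardySpace n) :
    inner ℂ (kernelLp hw) (bdryMap F) = (F : (Fin n → ℂ) → ℂ) w :=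
  MemHardy.inner_bdry_szego F.2 hw

namespace Rule

variable {Φ : Rule n}

/-- The functions attached to the points of a tuple, as elements of the Hardy space. -/
def systemHardy (hΦ : Φ.IsAdmissible) {m : ℕ} {p : Fin m → (Fin n → ℂ)}
    (hp : ∀ i, p i ∈ tube n) (k : Fin m) : hardySpace n :=
  ⟨Φ.system p k, hΦ.system_mem hp k⟩

/-- Admissibility gives independence as functions on the tube. It passes to boundary values because,
by the reproducing property, a function with zero boundary value vanishes at every point of the
tube. -/
theorem linearIndependent_bdryMap_systemHardy (hΦ : Φ.IsAdmissible) {m : ℕ}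
    {p : Fin m → (Fin n → ℂ)} (hp : ∀ i, p i ∈ tube n) :
    LinearIndependent ℂ fun k => bdryMap (systemHardy hΦ hp k) := by
  rw [Fintype.linearIndependent_iff]
  intro c hc
  refine Fintype.linearIndependent_iff.1 (hΦ m p hp).1 c ?_
  ext ⟨w, hw⟩
  have h1 : bdryMap (∑ k, c k • systemHardy hΦ hp k) = 0 := by
    simpa only [map_sum, map_smul] using hc
  have h2 := inner_kernelLp hw (∑ k, c k • systemHardy hΦ hp k)
  rw [h1, inner_zero_right] at h2
  simp only [Submodule.coe_sum, Submodule.coe_smul, Finset.sum_apply, Pi.smul_apply] at h2 ⊢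
  exact h2.symm

theorem gramMatrix_eq (hΦ : Φ.IsAdmissible) {m : ℕ} {p : Fin m → (Fin n → ℂ)}
    (hp : ∀ i, p i ∈ tube n) :
    gramMatrix (Φ.system p) = Matrix.gram ℂ fun k => bdryMap (systemHardy hΦ hp k) := by
  ext j k
  exact hardyInner_coe (systemHardy hΦ hp k) (systemHardy hΦ hp j)

/-- The difference between `F` and its approximant, as an element of the Hardy space. -/
theorem exists_residual (hΦ : Φ.IsAdmissible) (F : hardySpace n) {m : ℕ}
    {p : Fin m → (Fin n → ℂ)} (hp : ∀ i, p i ∈ tube n) :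
    ∃ R : hardySpace n, (R : (Fin n → ℂ) → ℂ) = F - approximant Φ F p ∧
      (∀ i, inner ℂ (bdryMap (systemHardy hΦ hp i)) (bdryMap R) = 0) ∧
      bdryMap F - bdryMap R ∈
        Submodule.span ℂ (Set.range fun k => bdryMap (systemHardy hΦ hp k)) := by
  set φ := fun k => bdryMap (systemHardy hΦ hp k) with hφ
  set d : Fin m → ℂ := fun k =>
    ∑ j, inner ℂ (φ j) (bdryMap F) * conj ((Matrix.gram ℂ φ)⁻¹ j k) with hd
  have hR : bdryMap (F - ∑ k, d k • systemHardy hΦ hp k) = bdryMap F - ∑ k, d k • φ k := by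
    simp only [map_sub, map_sum, map_smul, hφ]
  refine ⟨F - ∑ k, d k • systemHardy hΦ hp k, ?_, fun i => ?_, ?_⟩
  · rw [Submodule.coe_sub]
    congr 1
    ext w
    simp only [Submodule.coe_sum, Submodule.coe_smul, Finset.sum_apply, Pi.smul_apply,
      approximant, smul_eq_mul, hd, Finset.sum_mul]
    rw [Finset.sum_comm]
    refine Finset.sum_congr rfl fun j _ => Finset.sum_congr rfl fun k _ => ?_
    rw [gramMatrix_eq hΦ hp, ← hardyInner_coe F (systemHardy hΦ hp j)]
    rfl
  · rw [hR]
    exact inner_sub_gram_combination_eq_zero (linearIndependent_bdryMap_systemHardy hΦ hp) _ i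
  · rw [hR, sub_sub_cancel]
    exact Submodule.sum_mem _ fun k _ =>
      Submodule.smul_mem _ _ (Submodule.subset_span ⟨k, rfl⟩)

/-- The best approximation property of the approximants. -/
theorem norm_residual_sq_le (hΦ : Φ.IsAdmissible) (F : hardySpace n) {m : ℕ}
    {p : Fin m → (Fin n → ℂ)} (hp : ∀ i, p i ∈ tube n) {v : Lp ℂ 2 (volume : Measure (Fin n → ℝ))}
    (hv : v ∈ Submodule.span ℂ (Set.range fun k => bdryMap (systemHardy hΦ hp k))) :
    normSq ((F : (Fin n → ℂ) → ℂ) - approximant Φ F p) ≤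
      ENNReal.ofReal (‖bdryMap F - v‖ ^ 2) := by
  obtain ⟨R, hR, horth, hmem⟩ := exists_residual hΦ F hp
  rw [← hR, normSq_coe]
  refine ENNReal.ofReal_le_ofReal ?_
  have h1 := norm_add_sq_of_inner_eq_zero
    (inner_eq_zero_of_mem_span_range horth (Submodule.sub_mem _ hmem hv))
  rw [show bdryMap F - bdryMap R - v + bdryMap R = bdryMap F - v by abel] at h1
  have := sq_nonneg ‖bdryMap F - bdryMap R - v‖
  linarith

theorem system_snoc_castSucc {m : ℕ} (p : Fin m → (Fin n → ℂ)) (w : Fin n → ℂ) (k : Fin m) :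
    Φ.system (Fin.snoc (α := fun _ => Fin n → ℂ) p w) k.castSucc = Φ.system p k := by
  have h1 : (fun i : Fin (k : ℕ) => Fin.snoc (α := fun _ => Fin n → ℂ) p w
      (Fin.castLE k.castSucc.isLt.le i)) = fun i : Fin (k : ℕ) => p (Fin.castLE k.isLt.le i) := by
    ext1 i
    exact Fin.snoc_castSucc (α := fun _ => Fin n → ℂ) w p (Fin.castLE k.isLt.le i)
  have h2 : Fin.snoc (α := fun _ => Fin n → ℂ) p w k.castSucc = p k :=
    Fin.snoc_castSucc (α := fun _ => Fin n → ℂ) w p k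
  change Φ k (fun i : Fin (k : ℕ) => Fin.snoc (α := fun _ => Fin n → ℂ) p w
      (Fin.castLE k.castSucc.isLt.le i)) (Fin.snoc (α := fun _ => Fin n → ℂ) p w k.castSucc) = _
  rw [h1, h2]
  rfl

/-- The reproducing kernel at `w` gets into the span when `w` is appended to a tuple. -/
theorem kernelLp_mem_span (hΦ : Φ.IsAdmissible) {m : ℕ}
    {p : Fin m → (Fin n → ℂ)} (hp : ∀ i, p i ∈ tube n) (k : Fin m)
    (hk : ∀ j < k, p j ≠ p k) :
    kernelLp (hp k) ∈ Submodule.span ℂ (Set.range fun k => bdryMap (systemHardy hΦ hp k)) := by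
  obtain ⟨c, hc, hck⟩ := hΦ.exists_system_eq_smul_szego hp k hk
  have h1 : (⟨szego (p k), memHardy_szego (hp k)⟩ : hardySpace n) = c⁻¹ • systemHardy hΦ hp k := by
    apply Subtype.ext
    rw [Submodule.coe_smul]
    change _ = c⁻¹ • Φ.system p k
    rw [hck, smul_smul, inv_mul_cancel₀ hc, one_smul]
  rw [kernelLp, h1, map_smul]
  exact Submodule.smul_mem _ _ (Submodule.subset_span ⟨k, rfl⟩)

end Rule

/-- If the residuals decrease in an orthogonal way and tend to zero pointwise on the tube, then
they tend to zero in norm. -/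
theorem tendsto_norm_bdryMap_sq_zero {R : ℕ → hardySpace n}
    (horth : ∀ m l, m ≤ l →
      ‖bdryMap (R m) - bdryMap (R l)‖ ^ 2 = ‖bdryMap (R m)‖ ^ 2 - ‖bdryMap (R l)‖ ^ 2)
    (hR : ∀ w ∈ tube n, Tendsto (fun m => (R m : (Fin n → ℂ) → ℂ) w) atTop (𝓝 0)) :
    Tendsto (fun m => ‖bdryMap (R m)‖ ^ 2) atTop (𝓝 0) := by
  have hanti : Antitone fun m => ‖bdryMap (R m)‖ ^ 2 := fun m l hml => by
    have := horth m l hml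
    have := sq_nonneg ‖bdryMap (R m) - bdryMap (R l)‖
    simp only
    linarith
  have hbdd : BddBelow (Set.range fun m => ‖bdryMap (R m)‖ ^ 2) :=
    ⟨0, by rintro _ ⟨m, rfl⟩; positivity⟩
  have hlim := tendsto_atTop_ciInf hanti hbdd
  set a := ⨅ m, ‖bdryMap (R m)‖ ^ 2 with ha
  have ha0 : 0 ≤ a := le_ciInf fun m => by positivity
  -- On each slice `R m` is the pointwise limit of `R m - R l` as `l → ∞`, and the latter has
  -- squared norm `‖R m‖² - ‖R l‖² ≤ ‖R m‖² - a`. Fatou's lemma passes to the limit without any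
  -- completeness of the space.
  have hle : ∀ m, normSq (R m : (Fin n → ℂ) → ℂ) ≤ ENNReal.ofReal (‖bdryMap (R m)‖ ^ 2 - a) := by
    intro m
    refine iSup₂_le fun y hy => ?_
    have hslice : ∀ l, Continuous fun x => (R l : (Fin n → ℂ) → ℂ) (pt x y) := fun l =>
      MemHardy.continuous_slice (R l).2 hy
    calc ∫⁻ x : Fin n → ℝ, ‖(R m : (Fin n → ℂ) → ℂ) (pt x y)‖ₑ ^ 2
        = ∫⁻ x : Fin n → ℝ, liminf (fun l => ‖(R m : (Fin n → ℂ) → ℂ) (pt x y) -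
            (R l : (Fin n → ℂ) → ℂ) (pt x y)‖ₑ ^ 2) atTop := by
          refine lintegral_congr fun x => ?_
          have h1 := (hR (pt x y) (pt_mem_tube.2 hy)).const_sub ((R m : (Fin n → ℂ) → ℂ) (pt x y))
          rw [sub_zero] at h1
          exact (((ENNReal.continuous_pow 2).tendsto _).comp h1.enorm).liminf_eq.symm
      _ ≤ liminf (fun l => ∫⁻ x : Fin n → ℝ, ‖(R m : (Fin n → ℂ) → ℂ) (pt x y) -
            (R l : (Fin n → ℂ) → ℂ) (pt x y)‖ₑ ^ 2) atTop :=
          lintegral_liminf_le fun l =>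
            ((hslice m).sub (hslice l)).enorm.measurable.pow_const 2
      _ ≤ ENNReal.ofReal (‖bdryMap (R m)‖ ^ 2 - a) := by
          refine liminf_le_of_frequently_le' (Eventually.frequently ?_)
          filter_upwards [eventually_ge_atTop m] with l hl
          have h1 : ∫⁻ x : Fin n → ℝ, ‖(R m : (Fin n → ℂ) → ℂ) (pt x y) -
              (R l : (Fin n → ℂ) → ℂ) (pt x y)‖ₑ ^ 2 ≤
              normSq ((R m - R l : hardySpace n) : (Fin n → ℂ) → ℂ) :=
            MemHardy.lintegral_slice_le hy
          refine h1.trans ?_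
          rw [normSq_coe, map_sub, horth m l hl]
          exact ENNReal.ofReal_le_ofReal (sub_le_sub_left (ciInf_le hbdd l) _)
  have haz : a = 0 := by
    have h1 := hle 0
    rw [normSq_coe, ENNReal.ofReal_le_ofReal_iff (sub_nonneg.2 (ciInf_le hbdd 0))] at h1
    linarith
  rwa [haz] at hlim

theorem tendstoUniformlyOn_zero_of_norm_bdryMap {R : ℕ → hardySpace n}
    (h : Tendsto (fun m => ‖bdryMap (R m)‖ ^ 2) atTop (𝓝 0)) {A : Set (Fin n → ℂ)}
    (hA : IsCompact A) (hAT : A ⊆ tube n) :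
    TendstoUniformlyOn (fun m => (R m : (Fin n → ℂ) → ℂ)) 0 atTop A := by
  obtain ⟨δ, hδ, hsub⟩ := hA.exists_cthickening_subset_open isOpen_tube hAT
  obtain ⟨C, hC⟩ := exists_norm_sq_le_normSq n hδ
  rw [Metric.tendstoUniformlyOn_iff]
  intro ε hε
  have h1 : Tendsto (fun m => C * ‖bdryMap (R m)‖ ^ 2) atTop (𝓝 0) := by
    simpa using h.const_mul C
  filter_upwards [h1.eventually_lt_const (by positivity : 0 < ε ^ 2)] with m hm w hw
  have h2 := hC (R m) (R m).2 w ((Metric.closedBall_subset_cthickening hw δ).trans hsub)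
  rw [normSq_coe, ENNReal.toReal_ofReal (by positivity)] at h2
  rw [Pi.zero_apply, dist_zero_left]
  exact lt_of_pow_lt_pow_left₀ 2 hε.le (h2.trans_lt hm)

end HardyTube

/-! ### Convergence of the greedy selection. -/

theorem mainTheorem9 (n : ℕ) (hn : 0 < n) (Φ : HardyTube.Rule n) (hΦ : Φ.IsAdmissible)
    (F : (Fin n → ℂ) → ℂ) (hF : HardyTube.MemHardy F)
    (z : ℕ → (Fin n → ℂ)) (hz : HardyTube.IsSelected Φ F z)
    (A : Set (Fin n → ℂ)) (hA : IsCompact A) (hAT : A ⊆ HardyTube.tube n) :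
    TendstoUniformlyOn
      (fun (m : ℕ) (w : Fin n → ℂ) => HardyTube.approximant Φ F (fun i : Fin m => z i) w)
      F Filter.atTop A := by
  open HardyTube in
  have hzt : ∀ m, z m ∈ tube n := fun m => (hz m).1
  set f : hardySpace n := ⟨F, hF⟩ with hf
  have hp : ∀ m, ∀ i : Fin m, z i ∈ tube n := fun m i => hzt i
  choose R hR horth hmem using fun m : ℕ => Rule.exists_residual hΦ f (hp m)
  set V : ℕ → Submodule ℂ (Lp ℂ 2 (volume : Measure (Fin n → ℝ))) := fun m =>
    Submodule.span ℂ (Set.range fun k => bdryMap (Rule.systemHardy hΦ (hp m) k)) with hV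
  have hVmono : ∀ m l, m ≤ l → V m ≤ V l := by
    intro m l hml
    refine Submodule.span_mono ?_
    rintro _ ⟨k, rfl⟩
    exact ⟨Fin.castLE hml k, rfl⟩
  have hdec : ∀ m l, m ≤ l →
      ‖bdryMap (R m) - bdryMap (R l)‖ ^ 2 = ‖bdryMap (R m)‖ ^ 2 - ‖bdryMap (R l)‖ ^ 2 := by
    intro m l hml
    have h1 : bdryMap (R m) - bdryMap (R l) ∈ V l := by
      have := Submodule.sub_mem _ (hmem l) (hVmono m l hml (hmem m))
      rwa [sub_sub_sub_cancel_left] at this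
    have h2 := norm_add_sq_of_inner_eq_zero (inner_eq_zero_of_mem_span_range (horth l) h1)
    rw [sub_add_cancel] at h2
    linarith
  have hgain : ∀ w (hw : w ∈ tube n), ∀ m, ‖(R m : (Fin n → ℂ) → ℂ) w‖ ^ 2 ≤
      ‖kernelLp hw‖ ^ 2 * (‖bdryMap (R m)‖ ^ 2 - ‖bdryMap (R (m + 1))‖ ^ 2) := by
    intro w hw m
    have hker_congr : ∀ {w'} (_ : w' = w) (hw' : w' ∈ tube n), kernelLp hw' = kernelLp hw := by
      rintro _ rfl _; rfl
    rw [← inner_kernelLp hw]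
    -- The kernel at `w` is only known to enter the span at the first occurrence of `w`, hence the
    -- minimal index. In this case the left side is zero.
    by_cases hex : ∃ k, k < m ∧ z k = w
    · classical
      obtain ⟨hkm, hkw⟩ := Nat.find_spec hex
      have hker : kernelLp hw ∈ V m := by
        rw [← hker_congr hkw (hzt _)]
        exact Rule.kernelLp_mem_span hΦ (hp m) ⟨Nat.find hex, hkm⟩ fun j hj hjk =>
          Nat.find_min hex (m := j) hj ⟨j.2, hjk.trans hkw⟩
      rw [inner_eq_zero_of_mem_span_range (horth m) hker, norm_zero, ← hdec m (m + 1) m.le_succ, zero_pow two_ne_zero]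
      positivity
    · obtain ⟨t, ht⟩ := exists_norm_sub_smul_sq (kernelLp hw) (bdryMap (R m))
      rw [ht]
      refine mul_le_mul_of_nonneg_left (sub_le_sub_left ?_ _) (by positivity)
      set q : Fin (m + 1) → (Fin n → ℂ) :=
        Fin.snoc (α := fun _ => Fin n → ℂ) (fun i : Fin m => z i) w with hq
      have hqs : ∀ k : Fin m, q k.castSucc = z k := fun k =>
        Fin.snoc_castSucc (α := fun _ => Fin n → ℂ) w (fun i : Fin m => z i) k
      have hql : q (Fin.last m) = w :=
        Fin.snoc_last (α := fun _ => Fin n → ℂ) w (fun i : Fin m => z i)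
      have hqt : ∀ i, q i ∈ tube n := by
        intro i
        refine Fin.lastCases ?_ (fun k => ?_) i
        · rw [hql]; exact hw
        · rw [hqs]; exact hzt k
      have hVq : V m ≤
          Submodule.span ℂ (Set.range fun k => bdryMap (Rule.systemHardy hΦ hqt k)) := by
        refine Submodule.span_mono ?_
        rintro _ ⟨k, rfl⟩
        refine ⟨k.castSucc, ?_⟩
        have : Rule.systemHardy hΦ hqt k.castSucc = Rule.systemHardy hΦ (hp m) k :=
          Subtype.ext (Rule.system_snoc_castSucc _ w k)
        simp only [this]
      have hker : kernelLp hw ∈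
          Submodule.span ℂ (Set.range fun k => bdryMap (Rule.systemHardy hΦ hqt k)) := by
        have h1 := Rule.kernelLp_mem_span hΦ hqt (Fin.last m) fun j hj hjk => by
          rw [hql] at hjk
          obtain ⟨k, rfl⟩ := Fin.exists_castSucc_eq.2 hj.ne
          rw [hqs] at hjk
          exact hex ⟨k, k.2, hjk⟩
        rwa [hker_congr hql] at h1
      -- The competitor is the current approximant plus `t • K_w`, whose residual is `R m - t •
      -- K_w`. The minimality of `z m` then bounds `‖R (m+1)‖²` by its squared norm.
      have h1 := Rule.norm_residual_sq_le hΦ f hqt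
        (Submodule.add_mem _ (hVq (hmem m)) (Submodule.smul_mem _ t hker))
      have h2 := ((hz m).2 w hw).trans h1
      rw [← hR (m + 1), normSq_coe, ENNReal.ofReal_le_ofReal_iff (by positivity)] at h2
      rwa [show bdryMap f - (bdryMap f - bdryMap (R m) + t • kernelLp hw) =
        bdryMap (R m) - t • kernelLp hw by abel] at h2
  have hgap : Tendsto (fun m => ‖bdryMap (R m)‖ ^ 2 - ‖bdryMap (R (m + 1))‖ ^ 2) atTop (𝓝 0) := by
    have hanti : Antitone fun m => ‖bdryMap (R m)‖ ^ 2 := fun m l hml => by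
      have := hdec m l hml
      have := sq_nonneg ‖bdryMap (R m) - bdryMap (R l)‖
      simp only
      linarith
    have hlim := tendsto_atTop_ciInf hanti ⟨0, by rintro _ ⟨m, rfl⟩; positivity⟩
    simpa using hlim.sub (hlim.comp (tendsto_add_atTop_nat 1))
  have hpt : ∀ w ∈ tube n, Tendsto (fun m => (R m : (Fin n → ℂ) → ℂ) w) atTop (𝓝 0) := by
    intro w hw
    have h1 : Tendsto (fun m => ‖(R m : (Fin n → ℂ) → ℂ) w‖ ^ 2) atTop (𝓝 0) :=
      squeeze_zero (fun m => by positivity) (hgain w hw)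
        (by simpa using hgap.const_mul (‖kernelLp hw‖ ^ 2))
    have h2 := h1.sqrt
    simp only [Real.sqrt_zero, Real.sqrt_sq (norm_nonneg _)] at h2
    exact tendsto_zero_iff_norm_tendsto_zero.2 h2
  have hunif := tendstoUniformlyOn_zero_of_norm_bdryMap
    (tendsto_norm_bdryMap_sq_zero hdec hpt) hA hAT
  rw [Metric.tendstoUniformlyOn_iff] at hunif ⊢
  intro ε hε
  filter_upwards [hunif ε hε] with m hm w hw
  have := hm w hw
  rw [Pi.zero_apply, dist_zero_left, hR m, Pi.sub_apply] at this
  rw [dist_eq_norm]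
  exact this
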